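/- Let $d\ge 3$ and $m,k\ge 1$ be integers, let $\mathbb B^d$ be the open unit ball of $\mathbb R^d$, $\mathbb S^{d-1}$ the unit sphere with its (not normalized) surface measure, and let $C^\infty(\overline{\mathbb B^d},\mathbb C^m)$ be the space of $\mathbb C^m$-valued functions that are smooth up to the boundary on the closed unit ball. For pairs $\mathbf f=(f_1,f_2)$, $\mathbf g=(g_1,g_2)$ in $C^\infty(\overline{\mathbb B^d},\mathbb C^m)^2$ put $\mathbf D_i\mathbf f=(\partial_i f_1,\partial_i f_2)$, $$(\mathbf f|\mathbf g)_{\mathcal H^1}=\sum_{i=1}^d(\partial_i f_1|\partial_i g_1)_{L^2(\mathbb B^d,\mathbb C^m)}+(f_2|g_2)_{L^2(\mathbb B^d,\mathbb C^m)}+(f_1|g_1)_{L^2(\mathbb S^{d-1},\mathbb C^m)},$$ and, for $k\ge 2$, $$(\mathbf f|\mathbf g)_{\mathcal H^k}=\sum_{i_1,\dots,i_{k-1}=1}^d(\mathbf D_{i_1}\cdots\mathbf D_{i_{k-1}}\mathbf f\,|\,\mathbf D_{i_1}\cdots\mathbf D_{i_{k-1}}\mathbf g)_{\mathcal H^1}+(\mathbf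 f|\mathbf g)_{\mathcal H^1}.$$ Let $\|\cdot\|_{\mathcal H^k}$ be the induced norm and let $\mathcal H^k$ be the completion of $C^\infty(\overline{\mathbb B^d},\mathbb C^m)^2$ under it (which coincides, with equivalent norms, with $H^k\times H^{k-1}(\mathbb B^d,\mathbb C^m)$). Let $(\Lambda f)(\xi)=\sum_{j}\xi^j\partial_j f(\xi)$. Then the operator $\tilde{\mathbf L}:\mathcal D(\tilde{\mathbf L})\subseteq\mathcal H^k\to\mathcal H^k$ with domain $\mathcal D(\tilde{\mathbf L})=C^\infty(\overline{\mathbb B^d},\mathbb C^m)^2$ (the free generator), $$\tilde{\mathbf L}(f_1,f_2)=\bigl(-\Lambda f_1+f_2,\ \Delta f_1-\Lambda f_2-f_2\bigr),$$ is closable, and its closure $\mathbf L$ generates a strongly continuous semigroup $(\mathbf S(\tau))_{\tau\ge 0}$ of bounded operators on $\mathcal H^k$, which satisfies $$\|\mathbf S(\tau)\mathbf f\|_{\mathcal H^k}\le e^{(\frac d2-1)\tau}\|\mathbf f\|_{\mathcal H^k}\qquad\text{for all }\mathbf f\in\mathcal H^k,\ \tau\ge 0 .$$ -/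

import Mathlib

open MeasureTheory Metric Filter Topology
open scoped ContDiff NNReal ComplexConjugate

noncomputable section

namespace FreeWave

/-- The Euclidean space `ℝ^d`. -/
abbrev Sp (d : ℕ) : Type := EuclideanSpace ℝ (Fin d)

/-- The Hermitian space `ℂ^m`. -/
abbrev Tgt (m : ℕ) : Type := EuclideanSpace ℂ (Fin m)

/-! ### Smooth functions up to the boundary of the unit ball -/

/-- The space of `ℂ^m`-valued functions that are smooth on the closed unit ball of `ℝ^d` (smooth up
to the boundary: all one-sided derivatives exist and are continuous on the closed ball).  A function
on the closed ball is represented by its unique extension by zero to `ℝ^d`, so that two elements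
are equal iff they agree on the closed ball. -/
def SmoothBall (d m : ℕ) : Submodule ℂ (Sp d → Tgt m) where
  carrier := {f | ContDiffOn ℝ ∞ f (closedBall 0 1) ∧ ∀ x, x ∉ closedBall (0 : Sp d) 1 → f x = 0}
  add_mem' hf hg := ⟨hf.1.add hg.1, fun x hx => by simp [hf.2 x hx, hg.2 x hx]⟩
  zero_mem' := ⟨contDiffOn_const, fun _ _ => rfl⟩
  smul_mem' c f hf := ⟨hf.1.const_smul c, fun x hx => by simp [hf.2 x hx]⟩

theorem uniqueDiffOn_closedBall (d : ℕ) : UniqueDiffOn ℝ (closedBall (0 : Sp d) 1) :=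
  uniqueDiffOn_convex (convex_closedBall 0 1)
    ⟨0, ball_subset_interior_closedBall (mem_ball_self one_pos)⟩

variable {d m : ℕ}

theorem smooth_contDiffOn (f : SmoothBall d m) :
    ContDiffOn ℝ ∞ (f : Sp d → Tgt m) (closedBall 0 1) := f.2.1

theorem smooth_continuousOn (f : SmoothBall d m) :
    ContinuousOn (f : Sp d → Tgt m) (closedBall 0 1) := f.2.1.continuousOn

theorem smooth_differentiableOn (f : SmoothBall d m) :
    DifferentiableOn ℝ (f : Sp d → Tgt m) (closedBall 0 1) :=
  f.2.1.differentiableOn (by simp)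

theorem fderivWithin_eq_zero_of_notMem {f : Sp d → Tgt m} {x : Sp d}
    (hx : x ∉ closedBall (0 : Sp d) 1) : fderivWithin ℝ f (closedBall 0 1) x = 0 :=
  fderivWithin_zero_of_notMem_closure (by rwa [isClosed_closedBall.closure_eq])

/-- The partial derivative `∂_i`, acting componentwise on smooth functions on the closed ball (at
boundary points: the one-sided derivative, that is, the continuous extension from the interior). -/
def pderiv (i : Fin d) : SmoothBall d m →ₗ[ℂ] SmoothBall d m where
  toFun f := ⟨fun x => fderivWithin ℝ (f : Sp d → Tgt m) (closedBall 0 1) x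
      (EuclideanSpace.single i 1),
    ((smooth_contDiffOn f).fderivWithin (uniqueDiffOn_closedBall d) (by simp)).clm_apply contDiffOn_const,
    fun x hx => by simp [fderivWithin_eq_zero_of_notMem hx]⟩
  map_add' f g := by
    ext1; funext x
    by_cases hx : x ∈ closedBall (0 : Sp d) 1
    · have := fderivWithin_add (uniqueDiffOn_closedBall d x hx) ((smooth_differentiableOn f) x hx)
        ((smooth_differentiableOn g) x hx)
      simp [this]
    · simp [fderivWithin_eq_zero_of_notMem hx]
  map_smul' c f := by
    ext1; funext x
    by_cases hx : x ∈ closedBall (0 : Sp d) 1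
    · have := fderivWithin_const_smul (uniqueDiffOn_closedBall d x hx) (c := c)
        ((smooth_differentiableOn f) x hx)
      simp [this]
    · simp [fderivWithin_eq_zero_of_notMem hx]

/-- Multiplication by the `i`-th coordinate function, `(ξ^i f)(ξ) = ξ^i f(ξ)`. -/
def mulCoord (i : Fin d) : SmoothBall d m →ₗ[ℂ] SmoothBall d m where
  toFun f := ⟨fun x => (x i) • (f : Sp d → Tgt m) x,
    ContDiffOn.smul (EuclideanSpace.proj (𝕜 := ℝ) i).contDiff.contDiffOn (smooth_contDiffOn f),
    fun x hx => by simp [f.2.2 x hx]⟩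
  map_add' f g := by ext1; funext x; simp
  map_smul' c f := by ext1; funext x; exact smul_comm (x i) c ((f : Sp d → Tgt m) x)

/-- `(Λ f)(ξ) = ξ^j ∂_j f(ξ)`. -/
def Lam : SmoothBall d m →ₗ[ℂ] SmoothBall d m := ∑ j, mulCoord j ∘ₗ pderiv j

/-- The Laplacian `Δ f = ∑_j ∂_j ∂_j f`. -/
def Lap : SmoothBall d m →ₗ[ℂ] SmoothBall d m := ∑ j, pderiv j ∘ₗ pderiv j

/-- The formal free generator on pairs of smooth functions,
`L̃ (f₁, f₂) = (-Λ f₁ + f₂, Δ f₁ - Λ f₂ - f₂)`. -/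
def freeOp : (SmoothBall d m × SmoothBall d m) →ₗ[ℂ] (SmoothBall d m × SmoothBall d m) :=
  LinearMap.prod (-(Lam ∘ₗ LinearMap.fst ℂ _ _) + LinearMap.snd ℂ _ _)
    (Lap ∘ₗ LinearMap.fst ℂ _ _ - Lam ∘ₗ LinearMap.snd ℂ _ _ - LinearMap.snd ℂ _ _)

theorem freeOp_apply (f : SmoothBall d m × SmoothBall d m) :
    freeOp f = (-Lam f.1 + f.2, Lap f.1 - Lam f.2 - f.2) := rfl

/-- `D_i (f₁, f₂) = (∂_i f₁, ∂_i f₂)`. -/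
def pairDeriv (i : Fin d) :
    (SmoothBall d m × SmoothBall d m) →ₗ[ℂ] (SmoothBall d m × SmoothBall d m) :=
  (pderiv i).prodMap (pderiv i)

/-! ### The sesquilinear forms (linear in the first argument) -/

/-- `(f|g)` in `L²(𝔹^d, ℂ^m)`. -/
def ipBall (f g : SmoothBall d m) : ℂ :=
  ∫ ξ in ball (0 : Sp d) 1, ∑ j, (f : Sp d → Tgt m) ξ j * conj ((g : Sp d → Tgt m) ξ j)

/-- `(f|g)` in `L²(𝕊^{d-1}, ℂ^m)`, with respect to the (not normalized) surface measure. -/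
def ipSphere (f g : SmoothBall d m) : ℂ :=
  ∫ y : sphere (0 : Sp d) 1, ∑ j, (f : Sp d → Tgt m) y j * conj ((g : Sp d → Tgt m) y j)
    ∂(volume : Measure (Sp d)).toSphere

/-- The `𝓗¹` inner product
`(f₁|g₁)_{Ḣ¹(𝔹^d)} + (f₂|g₂)_{L²(𝔹^d)} + (f₁|g₁)_{L²(𝕊^{d-1})}`. -/
def ipOne (f g : SmoothBall d m × SmoothBall d m) : ℂ :=
  (∑ i, ipBall (pderiv i f.1) (pderiv i g.1)) + ipBall f.2 g.2 + ipSphere f.1 g.1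

/-- `∑_{i₁, …, i_n} (D_{i₁} ⋯ D_{i_n} f | D_{i₁} ⋯ D_{i_n} g)_{𝓗¹}`, the sum over all `n`-tuples of
indices.  For `k ≥ 2` and `n = k - 1` this is the homogeneous form `(f|g)_{𝓗̇^k}`. -/
def ipHom : ℕ → SmoothBall d m × SmoothBall d m → SmoothBall d m × SmoothBall d m → ℂ
  | 0, f, g => ipOne f g
  | n + 1, f, g => ∑ i, ipHom n (pairDeriv i f) (pairDeriv i g)

/-- The `𝓗^k` inner product: `(f|g)_{𝓗¹}` for `k = 1` and `(f|g)_{𝓗̇^k} + (f|g)_{𝓗¹}` for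
`k ≥ 2`.  (The value `k = 0` plays no role.) -/
def ipH (k : ℕ) (f g : SmoothBall d m × SmoothBall d m) : ℂ :=
  if k ≤ 1 then ipOne f g else ipHom (k - 1) f g + ipOne f g

/-! ### The forms are positive Hermitian forms -/

theorem sum_mul_conj (v w : Tgt m) : ∑ j, v j * conj (w j) = inner ℂ w v := by
  simp [PiLp.inner_apply]

theorem ipBall_eq (f g : SmoothBall d m) :
    ipBall f g = ∫ ξ in ball (0 : Sp d) 1,
      inner ℂ ((g : Sp d → Tgt m) ξ) ((f : Sp d → Tgt m) ξ) := by
  simp only [ipBall, sum_mul_conj]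

theorem ipSphere_eq (f g : SmoothBall d m) :
    ipSphere f g = ∫ y : sphere (0 : Sp d) 1,
      inner ℂ ((g : Sp d → Tgt m) y) ((f : Sp d → Tgt m) y)
        ∂(volume : Measure (Sp d)).toSphere := by
  simp only [ipSphere, sum_mul_conj]

theorem integrable_ball (f g : SmoothBall d m) :
    IntegrableOn (fun ξ => inner ℂ ((g : Sp d → Tgt m) ξ) ((f : Sp d → Tgt m) ξ))
      (ball (0 : Sp d) 1) :=
  (((smooth_continuousOn g).inner (smooth_continuousOn f)).integrableOn_compact
    (isCompact_closedBall _ _)).mono_set ball_subset_closedBall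

theorem smooth_continuous_sphere (f : SmoothBall d m) :
    Continuous (fun y : sphere (0 : Sp d) 1 => (f : Sp d → Tgt m) y) :=
  (smooth_continuousOn f).comp_continuous continuous_subtype_val fun y => sphere_subset_closedBall y.2

theorem integrable_sphere (f g : SmoothBall d m) :
    Integrable (fun y : sphere (0 : Sp d) 1 =>
      inner ℂ ((g : Sp d → Tgt m) y) ((f : Sp d → Tgt m) y))
      (volume : Measure (Sp d)).toSphere :=
  ((smooth_continuous_sphere g).inner (smooth_continuous_sphere f)).integrable_of_hasCompactSupport
    (HasCompactSupport.of_compactSpace _)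

/-- Positive semidefinite Hermitian forms, linear in the first argument. -/
structure IsHermForm {F : Type*} [AddCommGroup F] [Module ℂ F] (B : F → F → ℂ) : Prop where
  symm : ∀ f g, conj (B f g) = B g f
  nonneg : ∀ f, 0 ≤ (B f f).re
  add : ∀ f g h, B (f + g) h = B f h + B g h
  smul : ∀ (c : ℂ) f g, B (c • f) g = c * B f g

namespace IsHermForm

variable {F G : Type*} [AddCommGroup F] [Module ℂ F] [AddCommGroup G] [Module ℂ G]

theorem plus {B C : F → F → ℂ} (hB : IsHermForm B) (hC : IsHermForm C) :
    IsHermForm (fun f g => B f g + C f g) where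
  symm f g := by simp [hB.symm, hC.symm]
  nonneg f := by simpa using add_nonneg (hB.nonneg f) (hC.nonneg f)
  add f g h := by rw [hB.add, hC.add]; ring
  smul c f g := by rw [hB.smul, hC.smul]; ring

theorem sum {ι : Type*} {B : ι → F → F → ℂ} (s : Finset ι) (hB : ∀ i, IsHermForm (B i)) :
    IsHermForm (fun f g => ∑ i ∈ s, B i f g) where
  symm f g := by simp [(hB _).symm]
  nonneg f := by simpa using Finset.sum_nonneg fun i _ => (hB i).nonneg f
  add f g h := by simp [(hB _).add, Finset.sum_add_distrib]
  smul c f g := by simp [(hB _).smul, Finset.mul_sum]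

theorem comp {B : G → G → ℂ} (hB : IsHermForm B) (T : F →ₗ[ℂ] G) :
    IsHermForm (fun f g => B (T f) (T g)) where
  symm f g := hB.symm _ _
  nonneg f := hB.nonneg _
  add f g h := by rw [map_add, hB.add]
  smul c f g := by rw [map_smul, hB.smul]

/-- The pre-inner product (conjugate linear in the first argument) `⟪f, g⟫ = B g f`. -/
@[reducible] def core {B : F → F → ℂ} (hB : IsHermForm B) : PreInnerProductSpace.Core ℂ F where
  inner f g := B g f
  conj_inner_symm f g := hB.symm f g
  re_inner_nonneg f := hB.nonneg f
  add_left f g h := by rw [← hB.symm, hB.add, map_add, hB.symm, hB.symm]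
  smul_left f g c := by rw [← hB.symm, hB.smul, map_mul, hB.symm]

end IsHermForm

theorem isHermForm_ipBall : IsHermForm (ipBall (d := d) (m := m)) where
  symm f g := by
    rw [ipBall_eq, ipBall_eq, ← integral_conj]
    simp only [inner_conj_symm]
  nonneg f := by
    rw [ipBall_eq]
    have h := integral_re (𝕜 := ℂ) (integrable_ball f f)
    rw [← RCLike.re_eq_complex_re, ← h]
    exact integral_nonneg fun _ => inner_self_nonneg
  add f g h := by
    simp only [ipBall_eq, ← integral_add (integrable_ball f h) (integrable_ball g h)]
    simp
  smul c f g := by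
    simp only [ipBall_eq, ← integral_const_mul]
    simp

theorem isHermForm_ipSphere : IsHermForm (ipSphere (d := d) (m := m)) where
  symm f g := by
    rw [ipSphere_eq, ipSphere_eq, ← integral_conj]
    simp only [inner_conj_symm]
  nonneg f := by
    rw [ipSphere_eq]
    have h := integral_re (𝕜 := ℂ) (integrable_sphere f f)
    rw [← RCLike.re_eq_complex_re, ← h]
    exact integral_nonneg fun _ => inner_self_nonneg
  add f g h := by
    simp only [ipSphere_eq, ← integral_add (integrable_sphere f h) (integrable_sphere g h)]
    simp
  smul c f g := by
    simp only [ipSphere_eq, ← integral_const_mul]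
    simp

theorem isHermForm_ipOne : IsHermForm (ipOne (d := d) (m := m)) := by
  have h := ((IsHermForm.sum Finset.univ fun i => isHermForm_ipBall.comp (pderiv i ∘ₗ
    LinearMap.fst ℂ (SmoothBall d m) (SmoothBall d m))).plus
    (isHermForm_ipBall.comp (LinearMap.snd ℂ (SmoothBall d m) (SmoothBall d m)))).plus
      (isHermForm_ipSphere.comp (LinearMap.fst ℂ (SmoothBall d m) (SmoothBall d m)))
  exact h

theorem isHermForm_ipHom (n : ℕ) : IsHermForm (ipHom (d := d) (m := m) n) := by
  induction n with
  | zero => exact isHermForm_ipOne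
  | succ n ih => exact IsHermForm.sum _ fun i => ih.comp (pairDeriv i)

theorem isHermForm_ipH (k : ℕ) : IsHermForm (ipH (d := d) (m := m) k) := by
  by_cases hk : k ≤ 1
  · have e : ipH (d := d) (m := m) k = ipOne := by funext f g; simp [ipH, hk]
    rw [e]
    exact isHermForm_ipOne
  · have e : ipH (d := d) (m := m) k = fun f g => ipHom (k - 1) f g + ipOne f g := by
      funext f g; simp [ipH, hk]
    rw [e]
    exact (isHermForm_ipHom (k - 1)).plus isHermForm_ipOne

/-! ### The Hilbert space `𝓗^k` -/

/-- `C^∞(closed ball, ℂ^m)²`, to be equipped with the inner product of `𝓗^k`. -/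
def SmoothPair (d m _k : ℕ) : Type := SmoothBall d m × SmoothBall d m

variable {k : ℕ}

instance : AddCommGroup (SmoothPair d m k) :=
  inferInstanceAs (AddCommGroup (SmoothBall d m × SmoothBall d m))

instance : Module ℂ (SmoothPair d m k) :=
  inferInstanceAs (Module ℂ (SmoothBall d m × SmoothBall d m))

/-- The inner product of `𝓗^k` in Mathlib's convention (conjugate linear in the first argument). -/
@[reducible] def smoothPairCore (d m k : ℕ) : PreInnerProductSpace.Core ℂ (SmoothPair d m k) :=
  IsHermForm.core (F := SmoothPair d m k) (B := ipH k) (isHermForm_ipH (d := d) (m := m) k)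

instance : SeminormedAddCommGroup (SmoothPair d m k) :=
  @InnerProductSpace.Core.toSeminormedAddCommGroup ℂ _ _ _ _ (smoothPairCore d m k)

instance : InnerProductSpace ℂ (SmoothPair d m k) :=
  InnerProductSpace.ofCore (smoothPairCore d m k)

theorem SmoothPair.inner_def (f g : SmoothPair d m k) : inner ℂ f g = ipH k g f := rfl

theorem SmoothPair.norm_sq (f : SmoothPair d m k) : ‖f‖ ^ 2 = (ipH k f f).re :=
  InnerProductSpace.norm_sq_eq_re_inner (𝕜 := ℂ) f

/-- The Hilbert space `𝓗^k`: the completion of `C^∞(closed ball, ℂ^m)²` under `‖·‖_{𝓗^k}`. -/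
abbrev HSpace (d m k : ℕ) : Type := UniformSpace.Completion (SmoothPair d m k)

/-- The canonical map of `C^∞(closed ball, ℂ^m)²` into `𝓗^k`. -/
def toH (d m k : ℕ) : SmoothPair d m k →ₗ[ℂ] HSpace d m k :=
  (UniformSpace.Completion.toComplₗᵢ (𝕜 := ℂ) (E := SmoothPair d m k)).toLinearMap

theorem denseRange_toH (d m k : ℕ) : DenseRange (toH d m k) :=
  UniformSpace.Completion.denseRange_coe

/-! ### `‖·‖_{𝓗^k}` is a norm -/

theorem eq_zero_of_ipBall {f : SmoothBall d m} (h : (ipBall f f).re = 0) : f = 0 := by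
  rw [ipBall_eq, ← RCLike.re_eq_complex_re, ← integral_re (𝕜 := ℂ) (integrable_ball f f),
    integral_eq_zero_iff_of_nonneg (fun _ => inner_self_nonneg) (integrable_ball f f).re] at h
  have h0 : Set.EqOn (f : Sp d → Tgt m) 0 (ball 0 1) := by
    refine Measure.eqOn_open_of_ae_eq (μ := (volume : Measure (Sp d))) ?_ isOpen_ball
      ((smooth_continuousOn f).mono ball_subset_closedBall) continuousOn_const
    filter_upwards [h] with x hx
    have hx' : RCLike.re (inner ℂ ((f : Sp d → Tgt m) x) ((f : Sp d → Tgt m) x)) = 0 := hx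
    rw [inner_self_eq_norm_sq] at hx'
    simpa using hx'
  have h1 : Set.EqOn (f : Sp d → Tgt m) 0 (closedBall 0 1) :=
    h0.of_subset_closure (smooth_continuousOn f) continuousOn_const ball_subset_closedBall
      (by rw [closure_ball _ one_ne_zero])
  ext1; funext x
  by_cases hx : x ∈ closedBall (0 : Sp d) 1
  · exact h1 hx
  · exact f.2.2 x hx

theorem eq_zero_of_ipOne (hd : 0 < d) {f : SmoothBall d m × SmoothBall d m}
    (h : (ipOne f f).re = 0) : f = 0 := by
  have hB := isHermForm_ipBall (d := d) (m := m)
  have hS := isHermForm_ipSphere (d := d) (m := m)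
  simp only [ipOne, Complex.add_re, Complex.re_sum] at h
  have a1 : 0 ≤ ∑ i, (ipBall (pderiv i f.1) (pderiv i f.1)).re :=
    Finset.sum_nonneg fun i _ => hB.nonneg _
  have a2 := hB.nonneg f.2
  have a3 := hS.nonneg f.1
  have b1 : ∑ i, (ipBall (pderiv i f.1) (pderiv i f.1)).re = 0 := by linarith
  have b2 : (ipBall f.2 f.2).re = 0 := by linarith
  have b3 : (ipSphere f.1 f.1).re = 0 := by linarith
  rw [Finset.sum_eq_zero_iff_of_nonneg fun i _ => hB.nonneg _] at b1
  have c1 : ∀ i, pderiv i f.1 = 0 := fun i => eq_zero_of_ipBall (b1 i (Finset.mem_univ i))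
  have c2 : f.2 = 0 := eq_zero_of_ipBall b2
  have c3 : ∀ x ∈ closedBall (0 : Sp d) 1,
      fderivWithin ℝ (f.1 : Sp d → Tgt m) (closedBall 0 1) x = 0 := by
    intro x _
    apply ContinuousLinearMap.coe_injective
    refine (EuclideanSpace.basisFun (Fin d) ℝ).toBasis.ext fun i => ?_
    have := congrFun (congrArg Subtype.val (c1 i)) x
    simpa [pderiv] using this
  have c4 : ∀ x ∈ closedBall (0 : Sp d) 1, (f.1 : Sp d → Tgt m) x = (f.1 : Sp d → Tgt m) 0 :=
    fun x hx => (convex_closedBall (0 : Sp d) 1).is_const_of_fderivWithin_eq_zero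
      (smooth_differentiableOn f.1) c3 hx (mem_closedBall_self zero_le_one)
  have c5 : (f.1 : Sp d → Tgt m) 0 = 0 := by
    have : Nonempty (Fin d) := ⟨⟨0, hd⟩⟩
    rw [ipSphere_eq] at b3
    have e : ∀ y : sphere (0 : Sp d) 1, (f.1 : Sp d → Tgt m) y = (f.1 : Sp d → Tgt m) 0 :=
      fun y => c4 y (sphere_subset_closedBall y.2)
    simp only [e, integral_const] at b3
    have hne : (volume : Measure (Sp d)).toSphere.real Set.univ ≠ 0 := by
      rw [Measure.real, ENNReal.toReal_ne_zero]
      exact ⟨mt Measure.measure_univ_eq_zero.1 (Measure.toSphere_ne_zero (volume : Measure (Sp d))),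
        measure_ne_top _ _⟩
    rw [Complex.real_smul, Complex.re_ofReal_mul] at b3
    have b4 := (mul_eq_zero.1 b3).resolve_left hne
    rw [← RCLike.re_eq_complex_re, inner_self_eq_norm_sq] at b4
    simpa using b4
  refine Prod.ext ?_ c2
  ext1; funext x
  by_cases hx : x ∈ closedBall (0 : Sp d) 1
  · rw [c4 x hx, c5]; rfl
  · exact f.1.2.2 x hx

theorem toH_injective (hd : 0 < d) : Function.Injective (toH d m k) := by
  rw [injective_iff_map_eq_zero]
  intro f hf
  have h0 : ‖f‖ = 0 := by
    rw [← (UniformSpace.Completion.toComplₗᵢ (𝕜 := ℂ) (E := SmoothPair d m k)).norm_map f]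
    exact norm_eq_zero.2 hf
  have h1 : (ipH k f f).re = 0 := by rw [← SmoothPair.norm_sq, h0]; norm_num
  refine eq_zero_of_ipOne hd (f := f) ?_
  unfold ipH at h1
  split_ifs at h1
  · exact h1
  · have := (isHermForm_ipHom (d := d) (m := m) (k - 1)).nonneg f
    have := (isHermForm_ipOne (d := d) (m := m)).nonneg f
    rw [Complex.add_re] at h1
    linarith

/-! ### The free generator as an unbounded operator, and semigroups -/

/-- The formal free generator `L̃`, on `C^∞(closed ball, ℂ^m)²` as a subspace of `𝓗^k`. -/
def freeOpPair (d m k : ℕ) : SmoothPair d m k →ₗ[ℂ] SmoothPair d m k :=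
  (freeOp : (SmoothBall d m × SmoothBall d m) →ₗ[ℂ] (SmoothBall d m × SmoothBall d m))

/-- The free generator `L̃` as an unbounded operator on `𝓗^k` with domain
`C^∞(closed ball, ℂ^m)²` (embedded in `𝓗^k`). -/
def freeGenerator (d m k : ℕ) (hd : 0 < d) : HSpace d m k →ₗ.[ℂ] HSpace d m k where
  domain := LinearMap.range (toH d m k)
  toFun := (toH d m k ∘ₗ freeOpPair d m k) ∘ₗ
    ((LinearEquiv.ofInjective (toH d m k) (toH_injective hd)).symm :
      LinearMap.range (toH d m k) →ₗ[ℂ] SmoothPair d m k)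

theorem mem_graph_freeGenerator (hd : 0 < d) (x y : HSpace d m k) :
    (x, y) ∈ (freeGenerator d m k hd).graph ↔
      ∃ f : SmoothPair d m k, toH d m k f = x ∧ toH d m k (freeOpPair d m k f) = y := by
  rw [LinearPMap.mem_graph_iff]
  constructor
  · rintro ⟨⟨_, f, rfl⟩, rfl, h⟩
    refine ⟨f, rfl, ?_⟩
    refine Eq.trans ?_ h
    change _ = toH d m k (freeOpPair d m k ((LinearEquiv.ofInjective (toH d m k) (toH_injective hd)).symm
      (LinearEquiv.ofInjective (toH d m k) (toH_injective hd) f)))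
    rw [LinearEquiv.symm_apply_apply]
  · rintro ⟨f, rfl, rfl⟩
    refine ⟨⟨toH d m k f, f, rfl⟩, rfl, ?_⟩
    change toH d m k (freeOpPair d m k ((LinearEquiv.ofInjective (toH d m k) (toH_injective hd)).symm
      (LinearEquiv.ofInjective (toH d m k) (toH_injective hd) f))) = _
    rw [LinearEquiv.symm_apply_apply]

section Semigroup

variable {X : Type*} [NormedAddCommGroup X] [NormedSpace ℂ X]

/-- Strongly continuous one-parameter semigroups of bounded operators. -/
structure IsC0Semigroup (S : ℝ≥0 → X →L[ℂ] X) : Prop where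
  zero : S 0 = ContinuousLinearMap.id ℂ X
  add : ∀ s t, S (s + t) = (S s).comp (S t)
  continuous : ∀ x, Continuous fun t => S t x

/-- `A` is the generator of `S`: `x ∈ D(A)` and `A x = y` iff `(S(t) x - x) / t → y` as `t → 0+`.
In particular `D(A)` is the set of all `x` for which this limit exists. -/
def IsGeneratorOf (A : X →ₗ.[ℂ] X) (S : ℝ≥0 → X →L[ℂ] X) : Prop :=
  ∀ x y : X, (x, y) ∈ A.graph ↔
    Tendsto (fun t : ℝ≥0 => (((t : ℝ) : ℂ))⁻¹ • (S t x - x)) (𝓝[>] 0) (𝓝 y)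

end Semigroup

end FreeWave

end

/-!
The free generator `L̃` does not raise degrees: it maps pairs of polynomials of degree less than `n`
to such pairs (`freeOp_mem_polyLT`), and these form a finite-dimensional space. On it `L̃` is a
matrix, and can be exponentiated. What makes the exponentials of all these matrices fit together
are two facts.

* Dissipativity. `Re (L̃ f | f) ≤ (d/2 - 1) ‖f‖²` in `𝓗^k` (`re_ipH_freeOp_le`). For `k = 1` this is
  integration by parts: the boundary terms combine, thanks to the boundary term of the inner
  product, to at most `½ |f₁|²` on the sphere, and `½ ≤ d/2 - 1` because `d ≥ 3`. For `k ≥ 2` it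
  follows from the case `k = 1`, since `[D_i, L̃] = -D_i`. Hence the exponentials have norm at most
  `exp ((d/2 - 1) τ)`, uniformly in the degree.
* Density. The pairs of polynomials are dense in the domain of `L̃` for the graph norm, because
  polynomials are dense in every `C^N` norm (`exists_polyLT_cnorm_sub_lt`), and `L̃` is bounded from
  `C^(k+2)` to `C^k`, which embeds in `𝓗^k`.

So the exponentials extend to the whole space, and form a semigroup `S` with the asserted bound
(`IsDissipativeTower`). If `(x, y)` is in the closure of the graph of `L̃`, then
`S(t) x = x + t y + o(t)`; in particular `y` is determined by `x`, which is closability, and the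
closure `L` is a restriction of the generator of `S`. Conversely `l - L` is onto for real `l` beyond
`d/2 - 1`, because it is so on the polynomials and is bounded below; as the generator has no
eigenvalue there, it is not larger than `L`. This avoids the Lumer-Phillips and Hille-Yosida
theorems (`exists_semigroup_of_invariant_finiteDimensional`).

The divergence theorem on the ball (`intBall_pderiv`) is proved from polar coordinates, which give
it for radial vector fields, and from the vanishing of the integral of a derivative on `ℝ^d`.
-/

noncomputable section

namespace FreeWave

/-! ### Semigroups from finite-dimensional invariant subspaces -/

section AbstractSemigroup

variable {X : Type*} [NormedAddCommGroup X] [InnerProductSpace ℂ X] [CompleteSpace X]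

theorem hasDerivAt_exp_smul_apply (B : X →L[ℂ] X) (x : X) (s : ℝ) :
    HasDerivAt (fun s : ℝ => NormedSpace.exp (s • B) x) (NormedSpace.exp (s • B) (B x)) s :=
  ((ContinuousLinearMap.apply ℂ X x).restrictScalars ℝ).hasFDerivAt.comp_hasDerivAt s
    (hasDerivAt_exp_smul_const B s)

theorem hasDerivAt_exp_smul_apply' (B : X →L[ℂ] X) (x : X) (s : ℝ) :
    HasDerivAt (fun s : ℝ => NormedSpace.exp (s • B) x) (B (NormedSpace.exp (s • B) x)) s :=
  ((ContinuousLinearMap.apply ℂ X x).restrictScalars ℝ).hasFDerivAt.comp_hasDerivAt s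
    (hasDerivAt_exp_smul_const' B s)

/-- If `Re ⟪x, B x⟫ ≤ β ‖x‖²` for all `x`, then `‖exp (t B)‖ ≤ exp (β t)` for `t ≥ 0`, because
`exp (-2 β t) ‖exp (t B) x‖²` is nonincreasing. -/
theorem norm_exp_smul_apply_le {B : X →L[ℂ] X} {β : ℝ}
    (hB : ∀ x, (inner ℂ x (B x)).re ≤ β * ‖x‖ ^ 2) {t : ℝ} (ht : 0 ≤ t) (x : X) :
    ‖NormedSpace.exp (t • B) x‖ ≤ Real.exp (β * t) * ‖x‖ := by
  have hu := hasDerivAt_exp_smul_apply' B x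
  let : InnerProductSpace ℝ X := InnerProductSpace.rclikeToReal ℂ X
  have hφ : ∀ s : ℝ, HasDerivAt
      (fun s : ℝ => Real.exp (-2 * β * s) * ‖NormedSpace.exp (s • B) x‖ ^ 2)
      (Real.exp (-2 * β * s) * (-2 * β * 1) * ‖NormedSpace.exp (s • B) x‖ ^ 2 +
        Real.exp (-2 * β * s) *
          (2 * inner ℝ (NormedSpace.exp (s • B) x) (B (NormedSpace.exp (s • B) x)))) s :=
    fun s => (((hasDerivAt_id s).const_mul (-2 * β)).exp).mul (hu s).norm_sq
  have hanti : Antitone fun s : ℝ => Real.exp (-2 * β * s) * ‖NormedSpace.exp (s • B) x‖ ^ 2 := by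
    refine antitone_of_deriv_nonpos (fun s => (hφ s).differentiableAt) fun s => ?_
    rw [(hφ s).deriv]
    have h1 := hB (NormedSpace.exp (s • B) x)
    have h2 : inner ℝ (NormedSpace.exp (s • B) x) (B (NormedSpace.exp (s • B) x)) =
        (inner ℂ (NormedSpace.exp (s • B) x) (B (NormedSpace.exp (s • B) x))).re := rfl
    rw [h2]
    nlinarith [Real.exp_pos (-2 * β * s)]
  have h := hanti ht
  simp only [mul_zero, zero_smul, NormedSpace.exp_zero, Real.exp_zero, one_mul] at h
  have h3 : (Real.exp (β * t)) ^ 2 * Real.exp (-2 * β * t) = 1 := by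
    rw [← Real.exp_nat_mul, ← Real.exp_add]; norm_num; ring
  have h4 : ‖NormedSpace.exp (t • B) x‖ ^ 2 ≤ (Real.exp (β * t) * ‖x‖) ^ 2 := by
    rw [mul_pow]
    calc ‖NormedSpace.exp (t • B) x‖ ^ 2
        = (Real.exp (β * t)) ^ 2 *
          (Real.exp (-2 * β * t) * ‖NormedSpace.exp (t • B) x‖ ^ 2) := by
          rw [← mul_assoc, h3, one_mul]
      _ ≤ _ := by gcongr; simpa using h
  exact le_of_sq_le_sq h4 (by positivity)

/-- An increasing sequence of subspaces `V n` with dense union, together with bounded operators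
`B n` such that `V n` is invariant under `B n`, the restrictions to the `V n` are compatible, and
all `B n` satisfy `Re ⟪x, B n x⟫ ≤ β ‖x‖²`.  The common restriction of the `B n` to `⋃ n, V n` is
in general an unbounded operator. -/
structure IsDissipativeTower (β : ℝ) (V : ℕ → Submodule ℂ X) (B : ℕ → X →L[ℂ] X) : Prop where
  dense : Dense (⋃ n, (V n : Set X))
  mapsTo : ∀ n, ∀ x ∈ V n, B n x ∈ V n
  compat : ∀ m n, m ≤ n → ∀ x ∈ V m, B n x = B m x
  dissip : ∀ n x, (inner ℂ x (B n x)).re ≤ β * ‖x‖ ^ 2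

namespace IsDissipativeTower

variable {β : ℝ} {V : ℕ → Submodule ℂ X} {B : ℕ → X →L[ℂ] X}

theorem exp_apply_eq (h : IsDissipativeTower β V B) {m n : ℕ} (hmn : m ≤ n) {x : X}
    (hx : x ∈ V m) (t : ℝ) :
    NormedSpace.exp (t • B n) x = NormedSpace.exp (t • B m) x := by
  have hpow : ∀ j : ℕ, (B n ^ j) x = (B m ^ j) x ∧ (B m ^ j) x ∈ V m := by
    intro j
    induction j with
    | zero => simpa using hx
    | succ j ih =>
      rw [pow_succ', pow_succ', mul_apply_eq_comp, mul_apply_eq_comp, ih.1]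
      exact ⟨h.compat m n hmn _ ih.2, h.mapsTo m _ ih.2⟩
  have key : ∀ C : X →L[ℂ] X, HasSum (fun j : ℕ => ((j.factorial : ℝ)⁻¹ • (t ^ j • (C ^ j) x)))
      (NormedSpace.exp (t • C) x) := fun C => by
    have := (NormedSpace.exp_series_hasSum_exp' (𝕂 := ℝ) (t • C)).mapL
      (ContinuousLinearMap.apply ℂ X x)
    simpa [smul_pow] using this
  refine (key (B n)).unique ?_
  simpa only [(hpow _).1] using key (B m)

/-- The exponentials `exp (t B n)` converge strongly: they are uniformly bounded, and eventually
constant on each `V m`. -/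
theorem exists_tendsto (h : IsDissipativeTower β V B) (t : ℝ≥0) (x : X) :
    ∃ y, Tendsto (fun n => NormedSpace.exp ((t : ℝ) • B n) x) atTop (𝓝 y) := by
  refine cauchySeq_tendsto_of_complete (Metric.cauchySeq_iff.2 fun ε hε => ?_)
  obtain ⟨p, hp, hxp⟩ := h.dense.exists_dist_lt x
    (ε := ε / (2 * Real.exp (β * t))) (by positivity)
  obtain ⟨m, hm⟩ := Set.mem_iUnion.1 hp
  refine ⟨m, fun a ha b hb => ?_⟩
  have hle : ∀ n, ‖NormedSpace.exp ((t : ℝ) • B n) (x - p)‖ < ε / 2 := fun n => by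
    refine (norm_exp_smul_apply_le (h.dissip n) t.2 _).trans_lt ?_
    rw [dist_eq_norm, lt_div_iff₀ (by positivity)] at hxp
    rw [NNReal.val_eq_coe]
    linarith
  have e : NormedSpace.exp ((t : ℝ) • B a) x - NormedSpace.exp ((t : ℝ) • B b) x =
      NormedSpace.exp ((t : ℝ) • B a) (x - p) - NormedSpace.exp ((t : ℝ) • B b) (x - p) := by
    rw [map_sub, map_sub, h.exp_apply_eq ha hm, h.exp_apply_eq hb hm]; abel
  rw [dist_eq_norm, e]
  linarith [norm_sub_le (NormedSpace.exp ((t : ℝ) • B a) (x - p))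
    (NormedSpace.exp ((t : ℝ) • B b) (x - p)), hle a, hle b]

/-- The strong limit of the exponentials `exp (t B n)`. -/
def semigroup (h : IsDissipativeTower β V B) (t : ℝ≥0) : X →L[ℂ] X :=
  continuousLinearMapOfTendsto (fun n => NormedSpace.exp ((t : ℝ) • B n))
    (tendsto_pi_nhds.2 fun x => (h.exists_tendsto t x).choose_spec)

theorem tendsto_semigroup (h : IsDissipativeTower β V B) (t : ℝ≥0) (x : X) :
    Tendsto (fun n => NormedSpace.exp ((t : ℝ) • B n) x) atTop (𝓝 (h.semigroup t x)) :=
  (h.exists_tendsto t x).choose_spec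

theorem semigroup_apply (h : IsDissipativeTower β V B) {m : ℕ} {x : X} (hx : x ∈ V m) (t : ℝ≥0) :
    h.semigroup t x = NormedSpace.exp ((t : ℝ) • B m) x :=
  tendsto_nhds_unique (h.tendsto_semigroup t x) <| tendsto_const_nhds.congr' <|
    (eventually_ge_atTop m).mono fun _ hn => (h.exp_apply_eq hn hx t).symm

theorem norm_semigroup_le (h : IsDissipativeTower β V B) (t : ℝ≥0) (x : X) :
    ‖h.semigroup t x‖ ≤ Real.exp (β * t) * ‖x‖ :=
  le_of_tendsto (h.tendsto_semigroup t x).norm <|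
    Eventually.of_forall fun n => norm_exp_smul_apply_le (h.dissip n) t.2 x

theorem continuous_semigroup (h : IsDissipativeTower β V B) (x : X) :
    Continuous fun t => h.semigroup t x := by
  refine continuous_iff_continuousAt.2 fun t₀ => ?_
  rw [Metric.continuousAt_iff']
  intro ε hε
  set M := Real.exp (|β| * (t₀ + 1)) with hM
  obtain ⟨p, hp, hxp⟩ := h.dense.exists_dist_lt x (ε := ε / (3 * M)) (by positivity)
  obtain ⟨m, hm⟩ := Set.mem_iUnion.1 hp
  rw [dist_eq_norm, lt_div_iff₀ (by positivity)] at hxp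
  have hcont : Continuous fun t : ℝ≥0 => h.semigroup t p := by
    simp only [h.semigroup_apply hm]
    have h1 : Continuous fun s : ℝ => NormedSpace.exp (s • B m) p :=
      continuous_iff_continuousAt.2 fun s =>
        (hasDerivAt_exp_smul_apply (B m) p s).continuousAt
    exact h1.comp NNReal.continuous_coe
  have hle : ∀ t : ℝ≥0, t < t₀ + 1 → ‖h.semigroup t (x - p)‖ < ε / 3 := fun t ht => by
    have ht' : (t : ℝ) ≤ t₀ + 1 := by exact_mod_cast ht.le
    have h1 : Real.exp (β * t) ≤ M := by
      refine Real.exp_le_exp.2 ?_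
      exact (mul_le_mul_of_nonneg_right (le_abs_self β) t.2).trans
        (mul_le_mul_of_nonneg_left ht' (abs_nonneg β))
    have h2 := h.norm_semigroup_le t (x - p)
    have h3 := mul_le_mul_of_nonneg_right h1 (norm_nonneg (x - p))
    linarith
  have hlt : t₀ < t₀ + 1 := lt_add_of_pos_right _ one_pos
  filter_upwards [Metric.continuousAt_iff'.1 hcont.continuousAt (ε / 3) (by positivity),
    eventually_lt_nhds hlt] with t h1 h2
  have e : h.semigroup t x - h.semigroup t₀ x = h.semigroup t (x - p) - h.semigroup t₀ (x - p) +
      (h.semigroup t p - h.semigroup t₀ p) := by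
    rw [map_sub, map_sub]; abel
  rw [dist_eq_norm] at h1 ⊢
  rw [e]
  have := norm_add_le (h.semigroup t (x - p) - h.semigroup t₀ (x - p))
    (h.semigroup t p - h.semigroup t₀ p)
  have := norm_sub_le (h.semigroup t (x - p)) (h.semigroup t₀ (x - p))
  linarith [hle t h2, hle t₀ hlt]

theorem isC0Semigroup (h : IsDissipativeTower β V B) : IsC0Semigroup h.semigroup where
  zero := by
    ext x
    refine tendsto_nhds_unique (h.tendsto_semigroup 0 x) ?_
    simp [NormedSpace.exp_zero]
  add s t := by
    ext x
    refine tendsto_nhds_unique (h.tendsto_semigroup (s + t) x) ?_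
    have h1 : Tendsto (fun n => NormedSpace.exp ((s : ℝ) • B n)
        (NormedSpace.exp ((t : ℝ) • B n) x - h.semigroup t x)) atTop (𝓝 0) := by
      refine squeeze_zero_norm (fun n => norm_exp_smul_apply_le (h.dissip n) s.2 _) ?_
      have := ((h.tendsto_semigroup t x).sub_const (h.semigroup t x)).norm.const_mul
        (Real.exp (β * s))
      simpa using this
    have h2 := h1.add (h.tendsto_semigroup s (h.semigroup t x))
    rw [zero_add] at h2
    refine h2.congr fun n => ?_
    let : NormedAlgebra ℚ (X →L[ℂ] X) := NormedAlgebra.restrictScalars ℚ ℝ _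
    have hc : Commute ((s : ℝ) • B n) ((t : ℝ) • B n) :=
      ((Commute.refl (B n)).smul_left _).smul_right _
    rw [NNReal.coe_add, add_smul, NormedSpace.exp_add_of_commute hc, mul_apply_eq_comp]
    simp
  continuous := h.continuous_semigroup

/-- The graph of the common restriction of the operators `B n` to `⋃ n, V n`. -/
def towerGraph (V : ℕ → Submodule ℂ X) (B : ℕ → X →L[ℂ] X) : Set (X × X) :=
  {z | ∃ n, z.1 ∈ V n ∧ z.2 = B n z.1}

/-- First order expansion of the semigroup at time `0`, for pairs in the closed graph. -/
theorem norm_semigroup_sub_le (h : IsDissipativeTower β V B) {x y : X}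
    (hxy : (x, y) ∈ closure (towerGraph V B)) {t : ℝ≥0} {δ : ℝ}
    (hδ : ∀ s ≤ t, ‖h.semigroup s y - y‖ ≤ δ) :
    ‖h.semigroup t x - x - (t : ℝ) • y‖ ≤ δ * t := by
  set M := Real.exp (|β| * t) with hM
  have hMs : ∀ s : ℝ≥0, s ≤ t → ∀ z, ‖h.semigroup s z‖ ≤ M * ‖z‖ := fun s hs z => by
    refine (h.norm_semigroup_le s z).trans (mul_le_mul_of_nonneg_right ?_ (norm_nonneg z))
    have hs' : (s : ℝ) ≤ t := by exact_mod_cast hs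
    exact Real.exp_le_exp.2 ((mul_le_mul_of_nonneg_right (le_abs_self β) s.2).trans
        (mul_le_mul_of_nonneg_left hs' (abs_nonneg β)))
  have hM0 : 0 < M := Real.exp_pos _
  have main : ∀ ε > 0, ‖h.semigroup t x - x - (t : ℝ) • y‖ ≤ δ * t + ε * (M * t + M + 1) := by
    intro ε hε
    obtain ⟨⟨p, q⟩, ⟨m, hp, hq⟩, hd⟩ := Metric.mem_closure_iff.1 hxy ε hε
    simp only at hp hq
    rw [Prod.dist_eq, max_lt_iff, dist_eq_norm, dist_eq_norm] at hd
    obtain ⟨hd1, hd2⟩ := hd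
    simp only at hd1 hd2
    have hder : ∀ s ∈ Set.Icc (0 : ℝ) t, HasDerivWithinAt
        (fun s : ℝ => NormedSpace.exp (s • B m) p - s • y)
        (NormedSpace.exp (s • B m) q - y) (Set.Icc 0 t) s := fun s _ => by
      have h1 := hasDerivAt_exp_smul_apply (B m) p s
      have h2 := h1.sub ((hasDerivAt_id s).smul_const y)
      rw [hq]
      exact h2.hasDerivWithinAt.congr_deriv (by simp)
    have hbd : ∀ s ∈ Set.Ico (0 : ℝ) t, ‖NormedSpace.exp (s • B m) q - y‖ ≤ M * ε + δ := by
      intro s hs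
      lift s to ℝ≥0 using hs.1
      have hst : s ≤ t := by exact_mod_cast hs.2.le
      have hqm : q ∈ V m := hq ▸ h.mapsTo m p hp
      rw [← h.semigroup_apply hqm]
      have e : h.semigroup s q - y = (h.semigroup s y - y) - h.semigroup s (y - q) := by
        rw [map_sub]; abel
      rw [e]
      have h1 := hMs s hst (y - q)
      have h2 := mul_le_mul_of_nonneg_left hd2.le hM0.le
      linarith [norm_sub_le (h.semigroup s y - y) (h.semigroup s (y - q)), hδ s hst]
    have h3 := norm_image_sub_le_of_norm_deriv_le_segment' hder hbd t ⟨t.2, le_rfl⟩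
    simp only [zero_smul, NormedSpace.exp_zero, sub_zero, one_apply_eq_self] at h3
    rw [← h.semigroup_apply hp] at h3
    have e : h.semigroup t x - x - (t : ℝ) • y =
        (h.semigroup t p - (t : ℝ) • y - p) + h.semigroup t (x - p) - (x - p) := by
      rw [map_sub]; abel
    rw [e]
    have h4 := norm_sub_le ((h.semigroup t p - (t : ℝ) • y - p) + h.semigroup t (x - p)) (x - p)
    have h5 := norm_add_le (h.semigroup t p - (t : ℝ) • y - p) (h.semigroup t (x - p))
    have h6 := hMs t le_rfl (x - p)
    have h7 := mul_le_mul_of_nonneg_left hd1.le hM0.le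
    linarith
  refine le_of_forall_pos_le_add fun η hη => ?_
  have hc : 0 < M * t + M + 1 := by positivity
  have := main (η / (M * t + M + 1)) (by positivity)
  rwa [div_mul_cancel₀ _ hc.ne'] at this

/-- The generator of the semigroup extends the closed graph. -/
theorem tendsto_of_mem_closure (h : IsDissipativeTower β V B) {x y : X}
    (hxy : (x, y) ∈ closure (towerGraph V B)) :
    Tendsto (fun t : ℝ≥0 => (((t : ℝ) : ℂ))⁻¹ • (h.semigroup t x - x)) (𝓝[>] 0) (𝓝 y) := by
  rw [Metric.tendsto_nhds]
  intro ε hε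
  have hc : Tendsto (fun t => h.semigroup t y) (𝓝 0) (𝓝 y) := by
    have := (h.continuous_semigroup y).tendsto 0
    rwa [h.isC0Semigroup.zero] at this
  have h0 := Metric.tendsto_nhds.1 hc (ε / 2) (by positivity)
  obtain ⟨u, hu, hu'⟩ := exists_Ico_subset_of_mem_nhds h0 ⟨1, one_pos⟩
  filter_upwards [Ioo_mem_nhdsGT hu] with t ht
  have h1 := h.norm_semigroup_sub_le hxy (t := t) (δ := ε / 2) fun s hs => by
    have : s ∈ Set.Ico 0 u := ⟨zero_le, hs.trans_lt ht.2⟩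
    have := hu' this
    rw [Set.mem_ofPred_eq, dist_eq_norm] at this
    exact this.le
  have ht0 : (0 : ℝ) < t := ht.1
  have e : (((t : ℝ) : ℂ))⁻¹ • (h.semigroup t x - x) - y =
      (((t : ℝ) : ℂ))⁻¹ • (h.semigroup t x - x - (t : ℝ) • y) := by
    rw [smul_sub _ (h.semigroup t x - x), ← Complex.coe_smul (t : ℝ) y,
      inv_smul_smul₀ (by exact_mod_cast ht0.ne')]
  rw [dist_eq_norm, e, norm_smul, norm_inv, Complex.norm_real, Real.norm_of_nonneg ht0.le]
  calc (t : ℝ)⁻¹ * ‖h.semigroup t x - x - (t : ℝ) • y‖ ≤ (t : ℝ)⁻¹ * (ε / 2 * t) := by gcongr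
    _ = ε / 2 := by field_simp
    _ < ε := by linarith

/-- For real `l > β`, the range of `l - A`, with `A` the closed operator given by the tower, is
everything: on the finite-dimensional `V n` the operator `l - B n` is injective, hence onto, and the
bound `(l - β) ‖x‖ ≤ ‖(l - A) x‖` makes the range closed. -/
theorem exists_resolvent (h : IsDissipativeTower β V B) [∀ n, FiniteDimensional ℂ (V n)]
    {G : Submodule ℂ (X × X)} (hG : (G : Set (X × X)) = closure (towerGraph V B)) {l : ℝ}
    (hl : β < l) (z : X) : ∃ w ∈ G, (l : ℂ) • w.1 - w.2 = z := by
  have hbelow : ∀ n x, (l - β) * ‖x‖ ≤ ‖(l : ℂ) • x - B n x‖ := fun n x => by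
    rcases eq_or_ne x 0 with rfl | hx
    · simp
    have h1 : (inner ℂ x ((l : ℂ) • x - B n x)).re = l * ‖x‖ ^ 2 - (inner ℂ x (B n x)).re := by
      rw [inner_sub_right, inner_smul_right, inner_self_eq_norm_sq_to_K, Complex.sub_re,
        Complex.re_ofReal_mul]
      norm_cast
    have h2 := (Complex.re_le_norm _).trans (norm_inner_le_norm (𝕜 := ℂ) x ((l : ℂ) • x - B n x))
    have h3 := h.dissip n x
    have h4 : 0 < ‖x‖ := norm_pos_iff.2 hx
    refine le_of_mul_le_mul_left ?_ h4
    nlinarith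
  have hbelowG : ∀ w ∈ G, (l - β) * ‖w.1‖ ≤ ‖(l : ℂ) • w.1 - w.2‖ := by
    intro w hw
    have hw' : w ∈ closure (towerGraph V B) := hG ▸ hw
    refine closure_minimal (t := {w : X × X | (l - β) * ‖w.1‖ ≤ ‖(l : ℂ) • w.1 - w.2‖}) ?_
      (isClosed_le (by fun_prop) (by fun_prop)) hw'
    rintro ⟨p, q⟩ ⟨n, -, hq⟩
    simp only at hq
    rw [Set.mem_ofPred_eq, hq]
    exact hbelow n p
  have hsurj : ∀ n, ∀ z ∈ V n, ∃ w ∈ G, (l : ℂ) • w.1 - w.2 = z := by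
    intro n z hz
    let T : V n →ₗ[ℂ] V n := (((l : ℂ) • (1 : X →L[ℂ] X) - B n : X →L[ℂ] X) : X →ₗ[ℂ] X).restrict
      (fun x hx => (V n).sub_mem ((V n).smul_mem _ hx) (h.mapsTo n x hx))
    have hT : Function.Injective T := by
      rw [injective_iff_map_eq_zero]
      intro x hx
      have h1 : (l : ℂ) • (x : X) - B n x = 0 := by simpa [T] using congrArg Subtype.val hx
      have h2 := hbelow n x
      rw [h1, norm_zero] at h2
      have h3 : ‖(x : X)‖ = 0 :=
        le_antisymm (nonpos_of_mul_nonpos_right h2 (by linarith)) (norm_nonneg _)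
      exact Subtype.ext (norm_eq_zero.1 h3)
    obtain ⟨x, hx⟩ := LinearMap.injective_iff_surjective.1 hT ⟨z, hz⟩
    refine ⟨(x, B n x), ?_, by simpa [T] using congrArg Subtype.val hx⟩
    rw [← SetLike.mem_coe, hG]
    exact subset_closure ⟨n, x.2, rfl⟩
  obtain ⟨u, hu, huz⟩ := mem_closure_iff_seq_limit.1 (h.dense z)
  have hw : ∀ i, ∃ w ∈ G, (l : ℂ) • w.1 - w.2 = u i := fun i => by
    obtain ⟨n, hn⟩ := Set.mem_iUnion.1 (hu i)
    exact hsurj n _ hn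
  choose w hwG hwu using hw
  have hcau : CauchySeq fun i => (w i).1 := by
    rw [Metric.cauchySeq_iff]
    intro ε hε
    have hlβ : 0 < l - β := by linarith
    obtain ⟨N, hN⟩ := Metric.cauchySeq_iff.1 huz.cauchySeq ((l - β) * ε) (by positivity)
    refine ⟨N, fun a ha b hb => ?_⟩
    have h1 := hbelowG _ (G.sub_mem (hwG a) (hwG b))
    have h2 : (l : ℂ) • (w a - w b).1 - (w a - w b).2 = u a - u b := by
      rw [← hwu a, ← hwu b, Prod.fst_sub, Prod.snd_sub, smul_sub]; abel
    have h3 := hN a ha b hb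
    rw [h2] at h1
    rw [dist_eq_norm] at h3 ⊢
    exact lt_of_mul_lt_mul_left (h1.trans_lt h3) hlβ.le
  obtain ⟨x, hx⟩ := cauchySeq_tendsto_of_complete hcau
  have h2 : Tendsto (fun i => (w i).2) atTop (𝓝 ((l : ℂ) • x - z)) :=
    ((hx.const_smul (l : ℂ)).sub huz).congr fun i => by rw [← hwu i]; abel
  refine ⟨(x, (l : ℂ) • x - z), ?_, by simp⟩
  have hGc : IsClosed (G : Set (X × X)) := hG ▸ isClosed_closure
  exact hGc.mem_of_tendsto (hx.prodMk_nhds h2) (Eventually.of_forall hwG)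

/-- The generator of the semigroup does not exceed the closed graph `G`: if `x` were in the domain
of the generator but not in that of the closed operator, then the generator would have an
eigenvalue beyond the growth bound `β`. -/
theorem mem_of_tendsto (h : IsDissipativeTower β V B) [∀ n, FiniteDimensional ℂ (V n)]
    {G : Submodule ℂ (X × X)} (hG : (G : Set (X × X)) = closure (towerGraph V B)) {x y : X}
    (hxy : Tendsto (fun t : ℝ≥0 => (((t : ℝ) : ℂ))⁻¹ • (h.semigroup t x - x)) (𝓝[>] 0) (𝓝 y)) :
    (x, y) ∈ G := by
  obtain ⟨⟨x', y'⟩, hG', hz⟩ := h.exists_resolvent hG (lt_add_one β) (((β + 1 : ℝ) : ℂ) • x - y)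
  simp only at hz
  have hcl : (x', y') ∈ closure (towerGraph V B) := hG ▸ hG'
  -- The difference `v` of `x` and the solution in `G` would be an eigenvector for `β + 1`.
  set v := x - x' with hv
  have hyv : y - y' = ((β + 1 : ℝ) : ℂ) • v := by
    rw [hv, smul_sub]
    linear_combination (norm := module) hz
  have hlim : Tendsto (fun t : ℝ≥0 => (((t : ℝ) : ℂ))⁻¹ • (h.semigroup t v - v)) (𝓝[>] 0)
      (𝓝 (((β + 1 : ℝ) : ℂ) • v)) := by
    rw [← hyv]
    refine (hxy.sub (h.tendsto_of_mem_closure hcl)).congr fun t => ?_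
    rw [← smul_sub, hv, map_sub]
    congr 1; abel
  -- Compare the growth of `Re ⟪v, S t v⟫` with the bound on the norm of the semigroup.
  have hre : Tendsto (fun t : ℝ≥0 => (inner ℂ v ((((t : ℝ) : ℂ))⁻¹ • (h.semigroup t v - v))).re)
      (𝓝[>] 0) (𝓝 ((β + 1) * ‖v‖ ^ 2)) := by
    have h1 := (Complex.continuous_re.tendsto _).comp
      (Filter.Tendsto.inner (𝕜 := ℂ) (tendsto_const_nhds (x := v)) hlim)
    refine h1.congr' (Eventually.of_forall fun t => rfl) |>.trans (le_of_eq ?_)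
    rw [inner_smul_right, inner_self_eq_norm_sq_to_K, Complex.re_ofReal_mul]
    norm_cast
  have hslope : Tendsto (fun t : ℝ≥0 => ((t : ℝ))⁻¹ * (Real.exp (β * t) - 1) * ‖v‖ ^ 2)
      (𝓝[>] 0) (𝓝 (β * ‖v‖ ^ 2)) := by
    have h1 : HasDerivAt (fun s : ℝ => Real.exp (β * s)) β 0 := by
      simpa using ((hasDerivAt_id (0 : ℝ)).const_mul β).exp
    have h2 := h1.tendsto_slope_zero_right
    have h3 : Tendsto (fun t : ℝ≥0 => (t : ℝ)) (𝓝[>] 0) (𝓝[>] 0) := by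
      refine tendsto_nhdsWithin_iff.2 ⟨?_, ?_⟩
      · exact (NNReal.continuous_coe.tendsto 0).mono_left nhdsWithin_le_nhds
      · filter_upwards [self_mem_nhdsWithin] with t ht using ht
    have h4 := (h2.comp h3).mul_const (‖v‖ ^ 2)
    simpa [Function.comp_def] using h4
  have hle : (β + 1) * ‖v‖ ^ 2 ≤ β * ‖v‖ ^ 2 := by
    refine le_of_tendsto_of_tendsto hre hslope ?_
    filter_upwards [self_mem_nhdsWithin] with t ht
    have ht0 : (0 : ℝ) < t := ht
    rw [inner_smul_right, ← Complex.ofReal_inv, Complex.re_ofReal_mul, mul_assoc]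
    refine mul_le_mul_of_nonneg_left ?_ (by positivity)
    rw [inner_sub_right, inner_self_eq_norm_sq_to_K, Complex.sub_re]
    have h1 := (Complex.re_le_norm _).trans (norm_inner_le_norm (𝕜 := ℂ) v (h.semigroup t v))
    have h2 := h.norm_semigroup_le t v
    have h3 : (((‖v‖ : ℝ) : ℂ) ^ 2).re = ‖v‖ ^ 2 := by norm_cast
    have h4 := mul_le_mul_of_nonneg_left h2 (norm_nonneg v)
    simp only [Complex.coe_algebraMap, h3]
    nlinarith
  have hv0 : v = 0 := by
    have : ‖v‖ ^ 2 = 0 := le_antisymm (by nlinarith) (by positivity)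
    simpa using this
  have hx : x = x' := sub_eq_zero.1 (hv.symm.trans hv0)
  have hy : y = y' := sub_eq_zero.1 (by rw [hyv, hv0, smul_zero])
  rw [hx, hy]
  exact hG'

end IsDissipativeTower

/-- An operator whose graph is, up to closure, that of its restriction to an increasing sequence of
finite-dimensional invariant subspaces, and which is dissipative up to the shift `β` there, is
closable, and its closure generates a strongly continuous semigroup of growth `exp (β t)`. -/
theorem exists_semigroup_of_invariant_finiteDimensional {β : ℝ} (hβ : 0 ≤ β) (A : X →ₗ.[ℂ] X)
    (V : ℕ → Submodule ℂ X) [∀ n, FiniteDimensional ℂ (V n)] (hmono : Monotone V)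
    (hdense : Dense (⋃ n, (V n : Set X))) (hV : ∀ n, V n ≤ A.domain)
    (hinv : ∀ n (x : A.domain), (x : X) ∈ V n → A x ∈ V n)
    (hdiss : ∀ n (x : A.domain), (x : X) ∈ V n → (inner ℂ (x : X) (A x)).re ≤ β * ‖(x : X)‖ ^ 2)
    (hcore : (A.graph : Set (X × X)) ⊆ closure {z | ∃ n, z.1 ∈ V n ∧ z ∈ A.graph}) :
    A.IsClosable ∧ ∃ S : ℝ≥0 → X →L[ℂ] X, IsC0Semigroup S ∧ IsGeneratorOf A.closure S ∧
      ∀ (t : ℝ≥0) (x : X), ‖S t x‖ ≤ Real.exp (β * t) * ‖x‖ := by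
  -- Compose the restriction of `A` to `V n` with the orthogonal projection onto `V n`.
  let A' : ∀ n, V n →L[ℂ] X := fun n =>
    LinearMap.toContinuousLinearMap (A.toFun ∘ₗ Submodule.inclusion (hV n))
  let B : ℕ → X →L[ℂ] X := fun n => (A' n).comp (V n).orthogonalProjectionOnto
  have hBP : ∀ n x, B n x =
      A ⟨(V n).orthogonalProjectionOnto x, hV n ((V n).orthogonalProjectionOnto x).2⟩ :=
    fun n x => rfl
  have hB : ∀ n (x : A.domain), (x : X) ∈ V n → B n x = A x := fun n x hx => by
    rw [hBP]
    congr 1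
    exact Subtype.ext (by simpa using Submodule.starProjection_eq_self_iff.2 hx)
  have htower : IsDissipativeTower β V B :=
    { dense := hdense
      mapsTo := fun n x hx => by
        rw [hB n ⟨x, hV n hx⟩ hx]
        exact hinv n _ hx
      compat := fun m n hmn x hx => by
        rw [hB n ⟨x, hV m hx⟩ (hmono hmn hx), hB m ⟨x, hV m hx⟩ hx]
      dissip := fun n x => by
        set P := (V n).orthogonalProjectionOnto x with hP
        have h1 := hdiss n ⟨P, hV n P.2⟩ P.2
        have h2 : B n x ∈ V n := by rw [hBP]; exact hinv n _ P.2
        have h3 : inner ℂ x (B n x) = inner ℂ (P : X) (B n x) := by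
          have := Submodule.inner_starProjection_left_eq_right (V n) x (B n x)
          rw [Submodule.starProjection_eq_self_iff.2 h2] at this
          exact this.symm
        have h4 : ‖(P : X)‖ ≤ ‖x‖ := (V n).norm_starProjection_apply_le x
        rw [h3, hBP]
        refine h1.trans ?_
        -- As `0 ≤ β`, the bound for the projection `P` of `x` is at most the one for `x`.
        gcongr }
  have hgr : {z : X × X | ∃ n, z.1 ∈ V n ∧ z ∈ A.graph} =
      IsDissipativeTower.towerGraph V B := by
    ext ⟨x, y⟩
    constructor
    · rintro ⟨n, hx, hxy⟩
      refine ⟨n, hx, ?_⟩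
      obtain ⟨u, rfl, rfl⟩ := (LinearPMap.mem_graph_iff A).1 hxy
      exact (hB n u hx).symm
    · rintro ⟨n, hx, hy⟩
      simp only at hx hy
      refine ⟨n, hx, (LinearPMap.mem_graph_iff A).2 ⟨⟨x, hV n hx⟩, rfl, ?_⟩⟩
      rw [hy, ← hB n ⟨x, hV n hx⟩ hx]
  have hG : (A.graph.topologicalClosure : Set (X × X)) =
      closure (IsDissipativeTower.towerGraph V B) := by
    rw [Submodule.topologicalClosure_coe, ← hgr]
    refine subset_antisymm (closure_minimal hcore isClosed_closure) (closure_mono ?_)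
    rintro z ⟨n, -, hz⟩
    exact hz
  have hlim : ∀ {x y}, (x, y) ∈ A.graph.topologicalClosure → _ := fun {x y} hxy =>
    htower.tendsto_of_mem_closure (x := x) (y := y) (hG ▸ hxy)
  have hclos : A.IsClosable := by
    refine ⟨A.graph.topologicalClosure.toLinearPMap, (Submodule.toLinearPMap_graph_eq _ ?_).symm⟩
    rintro ⟨x, y⟩ hxy (rfl : x = 0)
    refine tendsto_nhds_unique (hlim hxy) ?_
    simp
  refine ⟨hclos, htower.semigroup, htower.isC0Semigroup, fun x y => ?_, htower.norm_semigroup_le⟩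
  rw [← hclos.graph_closure_eq_closure_graph]
  exact ⟨hlim, htower.mem_of_tendsto hG⟩

end AbstractSemigroup

variable {d m : ℕ}

/-! ### Commutation relations for smooth functions on the closed ball -/

theorem SmoothBall.ext_closedBall {f g : SmoothBall d m}
    (h : ∀ x ∈ closedBall (0 : Sp d) 1, (f : Sp d → Tgt m) x = (g : Sp d → Tgt m) x) : f = g := by
  ext1; funext x
  by_cases hx : x ∈ closedBall (0 : Sp d) 1
  · exact h x hx
  · rw [f.2.2 x hx, g.2.2 x hx]

theorem pderiv_apply (i : Fin d) (f : SmoothBall d m) (x : Sp d) :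
    (pderiv i f : Sp d → Tgt m) x =
      fderivWithin ℝ (f : Sp d → Tgt m) (closedBall 0 1) x (EuclideanSpace.single i 1) := rfl

theorem mulCoord_apply (i : Fin d) (f : SmoothBall d m) (x : Sp d) :
    (mulCoord i f : Sp d → Tgt m) x = x i • (f : Sp d → Tgt m) x := rfl

theorem smooth_hasFDerivWithinAt (f : SmoothBall d m) {x : Sp d} (hx : x ∈ closedBall (0 : Sp d) 1) :
    HasFDerivWithinAt (f : Sp d → Tgt m) (fderivWithin ℝ (f : Sp d → Tgt m) (closedBall 0 1) x)
      (closedBall 0 1) x :=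
  (smooth_differentiableOn f x hx).hasFDerivWithinAt

/-- The partial derivative is determined by any derivative within the closed ball. -/
theorem pderiv_eq_of_hasFDerivWithinAt {i : Fin d} {f : SmoothBall d m} {x : Sp d}
    (hx : x ∈ closedBall (0 : Sp d) 1) {f' : Sp d →L[ℝ] Tgt m}
    (h : HasFDerivWithinAt (f : Sp d → Tgt m) f' (closedBall 0 1) x) :
    (pderiv i f : Sp d → Tgt m) x = f' (EuclideanSpace.single i 1) := by
  rw [pderiv_apply, h.fderivWithin (uniqueDiffOn_closedBall d x hx)]

theorem sum_smul_single (v : Sp d) : ∑ i, v i • (EuclideanSpace.single i 1 : Sp d) = v := by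
  simpa using (EuclideanSpace.basisFun (Fin d) ℝ).sum_repr v

theorem fderivWithin_apply_eq_sum (f : SmoothBall d m) (x v : Sp d) :
    fderivWithin ℝ (f : Sp d → Tgt m) (closedBall 0 1) x v =
      ∑ i, v i • (pderiv i f : Sp d → Tgt m) x := by
  conv_lhs => rw [← sum_smul_single v]
  simp [pderiv_apply]

theorem coe_sum_apply {ι : Type*} (s : Finset ι) (f : ι → SmoothBall d m) (x : Sp d) :
    ((∑ i ∈ s, f i : SmoothBall d m) : Sp d → Tgt m) x = ∑ i ∈ s, (f i : Sp d → Tgt m) x := by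
  simp

theorem Lam_eq_sum (f : SmoothBall d m) : Lam f = ∑ j, mulCoord j (pderiv j f) := by
  simp [Lam]

theorem Lap_eq_sum (f : SmoothBall d m) : Lap f = ∑ j, pderiv j (pderiv j f) := by
  simp [Lap]

theorem Lam_apply (f : SmoothBall d m) (x : Sp d) :
    (Lam f : Sp d → Tgt m) x = fderivWithin ℝ (f : Sp d → Tgt m) (closedBall 0 1) x x := by
  rw [fderivWithin_apply_eq_sum, Lam_eq_sum, coe_sum_apply]
  rfl

theorem pderiv_pderiv_comm (i j : Fin d) (f : SmoothBall d m) :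
    pderiv i (pderiv j f) = pderiv j (pderiv i f) := by
  refine SmoothBall.ext_closedBall fun x hx => ?_
  have hsymm : IsSymmSndFDerivWithinAt ℝ (f : Sp d → Tgt m) (closedBall 0 1) x := by
    refine ((smooth_contDiffOn f) x hx).isSymmSndFDerivWithinAt (by simp; exact WithTop.coe_le_coe.2 le_top)
      (uniqueDiffOn_closedBall d) ?_ hx
    rw [interior_closedBall _ one_ne_zero, closure_ball _ one_ne_zero]
    exact hx
  have key : ∀ i j : Fin d, (pderiv i (pderiv j f) : Sp d → Tgt m) x =
      fderivWithin ℝ (fderivWithin ℝ (f : Sp d → Tgt m) (closedBall 0 1)) (closedBall 0 1) x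
        (EuclideanSpace.single i 1) (EuclideanSpace.single j 1) := by
    intro i j
    have h1 : DifferentiableWithinAt ℝ (fderivWithin ℝ (f : Sp d → Tgt m) (closedBall 0 1))
        (closedBall 0 1) x :=
      (((smooth_contDiffOn f).fderivWithin (m := ∞) (uniqueDiffOn_closedBall d)
        (by simp)).differentiableOn (by simp)) x hx
    have h2 := h1.hasFDerivWithinAt.clm_apply
      (hasFDerivWithinAt_const (EuclideanSpace.single j 1 : Sp d) x (closedBall 0 1))
    rw [pderiv_eq_of_hasFDerivWithinAt hx h2]
    simp
  rw [key, key, hsymm]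

theorem pderiv_mulCoord (i j : Fin d) (f : SmoothBall d m) :
    pderiv i (mulCoord j f) = mulCoord j (pderiv i f) + if i = j then f else 0 := by
  refine SmoothBall.ext_closedBall fun x hx => ?_
  have h1 : HasFDerivWithinAt (fun x : Sp d => x j) (EuclideanSpace.proj (𝕜 := ℝ) j)
      (closedBall 0 1) x := (EuclideanSpace.proj (𝕜 := ℝ) j).hasFDerivWithinAt
  have h2 := h1.smul (smooth_hasFDerivWithinAt f hx)
  rw [pderiv_eq_of_hasFDerivWithinAt hx h2]
  by_cases h : i = j
  · subst h
    simp [mulCoord_apply, pderiv_apply]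
  · simp [mulCoord_apply, pderiv_apply, h, Ne.symm h]

theorem mulCoord_comm (i j : Fin d) (f : SmoothBall d m) :
    mulCoord i (mulCoord j f) = mulCoord j (mulCoord i f) :=
  SmoothBall.ext_closedBall fun x _ => smul_comm (x i) (x j) ((f : Sp d → Tgt m) x)

theorem pderiv_Lam (i : Fin d) (f : SmoothBall d m) :
    pderiv i (Lam f) = Lam (pderiv i f) + pderiv i f := by
  simp only [Lam_eq_sum, map_sum, pderiv_mulCoord, Finset.sum_add_distrib, pderiv_pderiv_comm i]
  simp

theorem pderiv_Lap (i : Fin d) (f : SmoothBall d m) :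
    pderiv i (Lap f) = Lap (pderiv i f) := by
  simp only [Lap_eq_sum, map_sum]
  refine Finset.sum_congr rfl fun j _ => ?_
  rw [pderiv_pderiv_comm i j, pderiv_pderiv_comm i j]

theorem Lam_mulCoord (i : Fin d) (f : SmoothBall d m) :
    Lam (mulCoord i f) = mulCoord i (Lam f) + mulCoord i f := by
  simp only [Lam_eq_sum, map_sum, pderiv_mulCoord, map_add, Finset.sum_add_distrib,
    mulCoord_comm i]
  congr 1
  rw [Finset.sum_eq_single i] <;> simp +contextual

/-- `[D_i, L̃] = -D_i`: differentiation lowers the growth of the free evolution. -/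
theorem pairDeriv_freeOp (i : Fin d) (f : SmoothBall d m × SmoothBall d m) :
    pairDeriv i (freeOp f) = freeOp (pairDeriv i f) - pairDeriv i f := by
  refine Prod.ext ?_ ?_
  · simp only [pairDeriv, freeOp_apply, LinearMap.prodMap_apply, map_add, map_neg, pderiv_Lam,
      Prod.fst_sub]
    abel
  · simp only [pairDeriv, freeOp_apply, LinearMap.prodMap_apply, map_sub, pderiv_Lam, pderiv_Lap,
      Prod.snd_sub]
    abel

/-- The pointwise Hermitian product `∑ j, f_j conj (g_j)`, as a `ℂ¹`-valued smooth function. -/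
def pairing (f g : SmoothBall d m) : SmoothBall d 1 :=
  ⟨fun x => EuclideanSpace.single 0
      (inner ℂ ((g : Sp d → Tgt m) x) ((f : Sp d → Tgt m) x)),
    ((PiLp.continuousLinearEquiv 2 ℝ fun _ : Fin 1 => ℂ).symm.contDiff.comp_contDiffOn <|
      contDiffOn_pi.2 fun _ => (smooth_contDiffOn g).inner ℂ (smooth_contDiffOn f)).congr
      fun x _ => by
        ext j
        simp [Fin.fin_one_eq_zero j],
    fun x hx => by simp [f.2.2 x hx]⟩

theorem pairing_apply (f g : SmoothBall d m) (x : Sp d) :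
    (pairing f g : Sp d → Tgt 1) x 0 =
      inner ℂ ((g : Sp d → Tgt m) x) ((f : Sp d → Tgt m) x) := by
  simp [pairing]

theorem pderiv_pairing (i : Fin d) (f g : SmoothBall d m) :
    pderiv i (pairing f g) = pairing (pderiv i f) g + pairing f (pderiv i g) := by
  refine SmoothBall.ext_closedBall fun x hx => ?_
  ext j
  rw [Fin.fin_one_eq_zero j]
  have h1 : HasFDerivWithinAt (fun x => (pairing f g : Sp d → Tgt 1) x 0) _ (closedBall 0 1) x :=
    ((EuclideanSpace.proj (𝕜 := ℂ) (0 : Fin 1)).restrictScalars ℝ).hasFDerivAt.comp_hasFDerivWithinAt x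
      (smooth_hasFDerivWithinAt (pairing f g) hx)
  simp only [pairing_apply] at h1
  have h2 := HasFDerivWithinAt.inner ℂ (smooth_hasFDerivWithinAt g hx)
    (smooth_hasFDerivWithinAt f hx)
  have h3 := congrArg (fun L => L (EuclideanSpace.single i 1))
    ((uniqueDiffOn_closedBall d x hx).eq h1 h2)
  have h4 : ∀ a b : SmoothBall d 1, ((a + b : SmoothBall d 1) : Sp d → Tgt 1) x 0 =
    (a : Sp d → Tgt 1) x 0 + (b : Sp d → Tgt 1) x 0 := fun a b => rfl
  rw [h4, pairing_apply, pairing_apply]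
  simp only [pderiv_apply]
  simpa [fderivInnerCLM_apply, add_comm] using h3

/-! ### The divergence theorem on the unit ball -/

/-- Integration in polar coordinates. -/
theorem integral_eq_integral_sphere_Ioi {E F : Type*} [NormedAddCommGroup E] [NormedSpace ℝ E]
    [MeasurableSpace E] [BorelSpace E] [FiniteDimensional ℝ E] [Nontrivial E]
    [NormedAddCommGroup F] [NormedSpace ℝ F] (μ : Measure E) [μ.IsAddHaarMeasure] {H : E → F}
    (hH : Integrable H μ) :
    ∫ x, H x ∂μ = ∫ y : sphere (0 : E) 1,
      (∫ r in Set.Ioi (0 : ℝ), r ^ (Module.finrank ℝ E - 1) • H (r • (y : E))) ∂μ.toSphere := by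
  have hmp := μ.measurePreserving_homeomorphUnitSphereProd
  have hemb := (homeomorphUnitSphereProd E).measurableEmbedding
  set g : sphere (0 : E) 1 × Set.Ioi (0 : ℝ) → F := fun z => H ((z.2 : ℝ) • (z.1 : E)) with hg
  have hcomp : ∀ x : ({0}ᶜ : Set E), g (homeomorphUnitSphereProd E x) = H x := fun x => by
    have hx : ‖(x : E)‖ ≠ 0 := norm_ne_zero_iff.2 x.2
    simp [hg, smul_smul, hx]
  have hint : Integrable g (μ.toSphere.prod (.volumeIoiPow (Module.finrank ℝ E - 1))) := by
    rw [← hmp.integrable_comp_emb hemb]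
    have h1 : IntegrableOn H ({0}ᶜ : Set E) μ := hH.integrableOn
    rw [integrableOn_iff_comap_subtypeVal (measurableSet_singleton _).compl] at h1
    exact h1.congr (Eventually.of_forall fun x => (hcomp x).symm)
  calc ∫ x, H x ∂μ = ∫ x : ({0}ᶜ : Set E), H x ∂(μ.comap (↑)) := by
        rw [integral_subtype_comap (measurableSet_singleton _).compl H, restrict_compl_singleton]
    _ = ∫ z, g z ∂μ.toSphere.prod (.volumeIoiPow (Module.finrank ℝ E - 1)) := by
        rw [← hmp.integral_comp hemb g]
        exact integral_congr_ae (Eventually.of_forall fun x => (hcomp x).symm)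
    _ = _ := by
        rw [integral_prod _ hint]
        refine integral_congr_ae (Eventually.of_forall fun y => ?_)
        simp only [hg, Measure.volumeIoiPow, ENNReal.ofReal]
        rw [integral_withDensity_eq_integral_smul,
          integral_subtype_comap measurableSet_Ioi
            fun r => Real.toNNReal (r ^ (Module.finrank ℝ E - 1)) • H (r • (y : E)),
          setIntegral_congr_fun measurableSet_Ioi fun r hr => ?_]
        · simp only [NNReal.smul_def]
          rw [Real.coe_toNNReal _ (pow_nonneg (Set.mem_Ioi.1 hr).le _)]
        · exact (measurable_subtype_coe.pow_const _).real_toNNReal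

theorem smooth_integrable (f : SmoothBall d m) : Integrable (f : Sp d → Tgt m) :=
  ((smooth_continuousOn f).integrableOn_compact (isCompact_closedBall _ _)
    ).integrable_of_forall_notMem_eq_zero f.2.2

theorem integrable_sphere_restrict (f : SmoothBall d m) :
    Integrable (fun y : sphere (0 : Sp d) 1 => (f : Sp d → Tgt m) y)
      (volume : Measure (Sp d)).toSphere :=
  (smooth_continuous_sphere f).integrable_of_hasCompactSupport (HasCompactSupport.of_compactSpace _)

/-- The integral of a smooth function over the ball. -/
def intBall : SmoothBall d m →ₗ[ℂ] Tgt m where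
  toFun f := ∫ x, (f : Sp d → Tgt m) x
  map_add' f g := integral_add (smooth_integrable f) (smooth_integrable g)
  map_smul' c f := integral_smul c (f : Sp d → Tgt m)

/-- The integral of a smooth function over the sphere. -/
def intSphere : SmoothBall d m →ₗ[ℂ] Tgt m where
  toFun f := ∫ y : sphere (0 : Sp d) 1, (f : Sp d → Tgt m) y ∂(volume : Measure (Sp d)).toSphere
  map_add' f g := integral_add (integrable_sphere_restrict f) (integrable_sphere_restrict g)
  map_smul' c f := integral_smul c fun y : sphere (0 : Sp d) 1 => (f : Sp d → Tgt m) y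

theorem setIntegral_ball (f : SmoothBall d m) :
    ∫ x in ball (0 : Sp d) 1, (f : Sp d → Tgt m) x = intBall f := by
  have h1 : ball (0 : Sp d) 1 =ᵐ[volume] closedBall 0 1 := by
    refine (ball_subset_closedBall.eventuallyLE).antisymm ?_
    rw [ae_le_set, closedBall_sdiff_ball]
    exact Measure.addHaar_sphere_of_ne_zero _ _ one_ne_zero
  rw [setIntegral_congr_set h1]
  exact setIntegral_eq_integral_of_forall_compl_eq_zero f.2.2

theorem smooth_hasFDerivAt (f : SmoothBall d m) {x : Sp d} (hx : x ∈ ball (0 : Sp d) 1) :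
    HasFDerivAt (f : Sp d → Tgt m) (fderivWithin ℝ (f : Sp d → Tgt m) (closedBall 0 1) x) x :=
  (smooth_hasFDerivWithinAt f (ball_subset_closedBall hx)).hasFDerivAt
    (mem_of_superset (isOpen_ball.mem_nhds hx) ball_subset_closedBall)

/-- The divergence theorem for the radial vector field `x ↦ f(x) x`, by polar coordinates. -/
theorem intBall_Lam_add (hd : 0 < d) (f : SmoothBall d m) :
    intBall (Lam f + (d : ℂ) • f) = intSphere f := by
  have : Nonempty (Fin d) := ⟨⟨0, hd⟩⟩
  set g : SmoothBall d m := Lam f + (d : ℂ) • f with hg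
  have h0 : intBall g = ∫ x, (g : Sp d → Tgt m) x := rfl
  rw [h0, integral_eq_integral_sphere_Ioi volume (smooth_integrable g), finrank_euclideanSpace_fin]
  refine integral_congr_ae (Eventually.of_forall fun y => ?_)
  have hy : ‖(y : Sp d)‖ = 1 := mem_sphere_zero_iff_norm.1 y.2
  have hcb : ∀ r ∈ Set.Icc (0 : ℝ) 1, r • (y : Sp d) ∈ closedBall (0 : Sp d) 1 := fun r hr => by
    rw [mem_closedBall_zero_iff, norm_smul, hy, mul_one, Real.norm_of_nonneg hr.1]
    exact hr.2
  have hcont : ∀ F : SmoothBall d m,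
      ContinuousOn (fun r : ℝ => (F : Sp d → Tgt m) (r • (y : Sp d))) (Set.Icc 0 1) := fun F =>
    (smooth_continuousOn F).comp (continuous_id.smul continuous_const).continuousOn hcb
  have hrestrict : ∫ r in Set.Ioi (0 : ℝ), r ^ (d - 1) • (g : Sp d → Tgt m) (r • (y : Sp d)) =
      ∫ r in Set.Ioc (0 : ℝ) 1, r ^ (d - 1) • (g : Sp d → Tgt m) (r • (y : Sp d)) := by
    refine setIntegral_eq_of_subset_of_forall_sdiff_eq_zero measurableSet_Ioi
      Set.Ioc_subset_Ioi_self fun r hr => ?_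
    have h1 : (0 : ℝ) < r := hr.1
    have h2 : 1 < r := by
      by_contra h
      exact hr.2 ⟨h1, not_lt.1 h⟩
    rw [g.2.2, smul_zero]
    rw [mem_closedBall_zero_iff, norm_smul, hy, mul_one, Real.norm_of_nonneg h1.le]
    exact not_le.2 h2
  simp only
  rw [hrestrict, ← intervalIntegral.integral_of_le zero_le_one,
    intervalIntegral.integral_eq_sub_of_hasDerivAt_of_le zero_le_one
      (f := fun r : ℝ => r ^ d • (f : Sp d → Tgt m) (r • (y : Sp d)))]
  · simp [hd.ne']
  · exact (continuous_pow d).continuousOn.smul (hcont f)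
  · intro r hr
    have hb : r • (y : Sp d) ∈ ball (0 : Sp d) 1 := by
      rw [mem_ball_zero_iff, norm_smul, hy, mul_one, Real.norm_of_nonneg hr.1.le]
      exact hr.2
    have h1 := (smooth_hasFDerivAt f hb).comp_hasDerivAt r ((hasDerivAt_id r).smul_const (y : Sp d))
    have h2 := (hasDerivAt_pow d r).smul h1
    refine h2.congr_deriv ?_
    have h3 : (g : Sp d → Tgt m) (r • (y : Sp d)) =
      fderivWithin ℝ (f : Sp d → Tgt m) (closedBall 0 1) (r • (y : Sp d)) (r • (y : Sp d)) +
        (d : ℂ) • (f : Sp d → Tgt m) (r • (y : Sp d)) := by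
      rw [← Lam_apply]; rfl
    rw [h3]
    obtain ⟨e, rfl⟩ : ∃ e, d = e + 1 := ⟨d - 1, by omega⟩
    simp only [Function.comp_apply, id_eq, one_smul, map_smul, Nat.add_sub_cancel]
    rw [← Complex.ofReal_natCast, Complex.coe_smul]
    module
  · refine ContinuousOn.intervalIntegrable ?_
    rw [Set.uIcc_of_le zero_le_one]
    exact (continuous_pow (d - 1)).continuousOn.smul (hcont g)

/-- Multiplication by the defining function `1 - |ξ|²` of the ball. -/
def mulWeight : SmoothBall d m →ₗ[ℂ] SmoothBall d m :=
  LinearMap.id - ∑ i, mulCoord i ∘ₗ mulCoord i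

theorem mulWeight_eq (f : SmoothBall d m) :
    mulWeight f = f - ∑ i, mulCoord i (mulCoord i f) := by
  simp [mulWeight]

theorem mulWeight_apply (f : SmoothBall d m) (x : Sp d) :
    (mulWeight f : Sp d → Tgt m) x = (1 - ‖x‖ ^ 2) • (f : Sp d → Tgt m) x := by
  have h : (mulWeight f : Sp d → Tgt m) x =
      (f : Sp d → Tgt m) x - ∑ i, x i • x i • (f : Sp d → Tgt m) x := by
    rw [mulWeight_eq]
    change (f : Sp d → Tgt m) x - _ = _
    rw [coe_sum_apply]
    rfl
  rw [h, EuclideanSpace.real_norm_sq_eq, sub_smul, one_smul, Finset.sum_smul]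
  simp only [smul_smul, pow_two]

theorem mulCoord_mulWeight (i : Fin d) (f : SmoothBall d m) :
    mulCoord i (mulWeight f) = mulWeight (mulCoord i f) := by
  simp only [mulWeight_eq, map_sub, map_sum, mulCoord_comm i]

theorem pderiv_mulWeight (i : Fin d) (f : SmoothBall d m) :
    pderiv i (mulWeight f) = mulWeight (pderiv i f) - (2 : ℂ) • mulCoord i f := by
  have h : ∀ j, pderiv i (mulCoord j (mulCoord j f)) =
      mulCoord j (mulCoord j (pderiv i f)) + (2 : ℂ) • if i = j then mulCoord j f else 0 := by
    intro j
    rw [pderiv_mulCoord, pderiv_mulCoord]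
    split_ifs
    · rw [map_add, two_smul]; abel
    · simp
  simp only [mulWeight_eq, map_sub, map_sum, h, Finset.sum_add_distrib, ← Finset.smul_sum]
  simp
  abel

theorem Lam_mulWeight (f : SmoothBall d m) :
    Lam (mulWeight f) = mulWeight (Lam f) + (2 : ℂ) • mulWeight f - (2 : ℂ) • f := by
  simp only [mulWeight_eq, map_sub, map_sum, Lam_mulCoord, map_add, Finset.sum_add_distrib]
  module

theorem intSphere_mulWeight (f : SmoothBall d m) : intSphere (mulWeight f) = 0 := by
  refine integral_eq_zero_of_ae (Eventually.of_forall fun y => ?_)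
  simp only [mulWeight_apply, mem_sphere_zero_iff_norm.1 y.2]
  simp

/-- The function `(1 - |ξ|²)² f`, extended by zero, is differentiable on all of `ℝ^d`: it vanishes
to second order at the sphere. -/
theorem hasFDerivAt_mulWeight_mulWeight (f : SmoothBall d m) (x : Sp d) :
    HasFDerivAt (mulWeight (mulWeight f) : Sp d → Tgt m)
      (fderivWithin ℝ (mulWeight (mulWeight f) : Sp d → Tgt m) (closedBall 0 1) x) x := by
  rcases lt_trichotomy ‖x‖ 1 with hx | hx | hx
  · exact smooth_hasFDerivAt _ (mem_ball_zero_iff.2 hx)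
  · have hxc : x ∈ closedBall (0 : Sp d) 1 := mem_closedBall_zero_iff.2 hx.le
    obtain ⟨C, hC⟩ := (isCompact_closedBall (0 : Sp d) 1).exists_bound_of_continuousOn
      (smooth_continuousOn f)
    have hC0 : 0 ≤ C := (norm_nonneg _).trans (hC x hxc)
    have hO : (mulWeight (mulWeight f) : Sp d → Tgt m) =O[𝓝 x] fun y => ‖y - x‖ ^ 2 := by
      refine Asymptotics.IsBigO.of_bound (4 * C) (Eventually.of_forall fun y => ?_)
      by_cases hy : y ∈ closedBall (0 : Sp d) 1
      · have h1 : ‖y‖ ≤ 1 := mem_closedBall_zero_iff.1 hy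
        have h2 : 1 - ‖y‖ ≤ ‖y - x‖ := by
          rw [← hx, norm_sub_rev]; exact norm_sub_norm_le x y
        have h3 : |1 - ‖y‖ ^ 2| ≤ 2 * ‖y - x‖ := by
          rw [abs_of_nonneg (by nlinarith [norm_nonneg y])]
          nlinarith [norm_nonneg y, norm_nonneg (y - x)]
        rw [mulWeight_apply, mulWeight_apply, norm_smul, norm_smul, Real.norm_eq_abs,
          Real.norm_of_nonneg (by positivity)]
        calc |1 - ‖y‖ ^ 2| * (|1 - ‖y‖ ^ 2| * ‖(f : Sp d → Tgt m) y‖)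
            ≤ (2 * ‖y - x‖) * ((2 * ‖y - x‖) * C) := by
              gcongr
              exact hC y hy
          _ = 4 * C * ‖y - x‖ ^ 2 := by ring
      · rw [(mulWeight (mulWeight f)).2.2 y hy, norm_zero]
        positivity
    have h := hO.hasFDerivAt (𝕜 := ℝ) one_lt_two
    rwa [h.hasFDerivWithinAt.fderivWithin (uniqueDiffOn_closedBall d x hxc)]
  · have hxc : x ∉ closedBall (0 : Sp d) 1 := by rwa [mem_closedBall_zero_iff, not_le]
    rw [fderivWithin_eq_zero_of_notMem hxc]
    refine (hasFDerivAt_const (0 : Tgt m) x).congr_of_eventuallyEq ?_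
    filter_upwards [isClosed_closedBall.isOpen_compl.mem_nhds hxc] with y hy
    exact (mulWeight (mulWeight f)).2.2 y hy

theorem intBall_pderiv_mulWeight_mulWeight (i : Fin d) (f : SmoothBall d m) :
    intBall (pderiv i (mulWeight (mulWeight f))) = 0 := by
  have h := integral_bilinear_hasLineDerivAt_right_eq_neg_left_of_integrable
    (μ := (volume : Measure (Sp d))) (f := fun _ => (1 : ℝ)) (f' := fun _ => 0)
    (g := (mulWeight (mulWeight f) : Sp d → Tgt m))
    (g' := (pderiv i (mulWeight (mulWeight f)) : Sp d → Tgt m))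
    (v := EuclideanSpace.single i 1) (B := ContinuousLinearMap.lsmul ℝ ℝ)
    (by simp) (by simpa using smooth_integrable _) (by simpa using smooth_integrable _)
    (fun x _ => by simpa using (hasFDerivAt_const (1 : ℝ) x).hasLineDerivAt _)
    (fun x _ => (hasFDerivAt_mulWeight_mulWeight f x).hasLineDerivAt _)
  simp only [ContinuousLinearMap.lsmul_apply, one_smul, zero_smul, integral_zero, neg_zero] at h
  exact h

/-- Integration against `1 - |ξ|²` is removed by the divergence theorem for `(1 - |ξ|²) f(ξ) ξ`,
which has no boundary term. -/
theorem intBall_mulWeight (hd : 0 < d) (f : SmoothBall d m) :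
    intBall (mulWeight (Lam f + ((d : ℂ) + 2) • f)) = (2 : ℂ) • intBall f := by
  have h := intBall_Lam_add hd (mulWeight f)
  rw [intSphere_mulWeight, Lam_mulWeight] at h
  simp only [map_add, map_sub, map_smul] at h ⊢
  linear_combination (norm := module) h

theorem intBall_mulWeight_mulWeight (hd : 0 < d) (f : SmoothBall d m) :
    intBall (mulWeight (mulWeight (Lam f + ((d : ℂ) + 4) • f))) =
      (4 : ℂ) • intBall (mulWeight f) := by
  have h := intBall_mulWeight hd (mulWeight f)
  rw [Lam_mulWeight] at h
  simp only [map_add, map_sub, map_smul] at h ⊢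
  linear_combination (norm := module) h

theorem intBall_mulWeight_mulWeight_pderiv (i : Fin d) (f : SmoothBall d m) :
    intBall (mulWeight (mulWeight (pderiv i f))) = (4 : ℂ) • intBall (mulWeight (mulCoord i f)) := by
  have h := intBall_pderiv_mulWeight_mulWeight i f
  simp only [pderiv_mulWeight, map_sub, map_smul, mulCoord_mulWeight] at h
  linear_combination (norm := module) h

/-- The divergence theorem on the ball for a coordinate vector field.  It follows from
`∫ ∂_i ((1 - |ξ|²)² f) = 0` by removing the weight: integrating `Λ`, up to a constant, against
`(1 - |ξ|²)^(j + 1)` is the same as integrating against `(1 - |ξ|²)^j`, and `Λ` commutes with `∂_i`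
and `ξ^i` up to a constant. -/
theorem intBall_pderiv (i : Fin d) (f : SmoothBall d m) :
    intBall (pderiv i f) = intSphere (mulCoord i f) := by
  have hd : 0 < d := i.pos
  obtain ⟨g, hg⟩ : ∃ g, g = Lam f + ((d : ℂ) + 1) • f := ⟨_, rfl⟩
  obtain ⟨k, hk⟩ : ∃ k, k = Lam g + ((d : ℂ) + 3) • g := ⟨_, rfl⟩
  have e1 : Lam (pderiv i f) + ((d : ℂ) + 2) • pderiv i f = pderiv i g := by
    rw [hg, map_add, pderiv_Lam, map_smul]; module
  have e2 : Lam (pderiv i g) + ((d : ℂ) + 4) • pderiv i g = pderiv i k := by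
    rw [hk, map_add, pderiv_Lam, map_smul]; module
  have e3 : mulCoord i k = Lam (mulCoord i g) + ((d : ℂ) + 2) • mulCoord i g := by
    rw [hk, map_add, Lam_mulCoord, map_smul]; module
  have e4 : mulCoord i g = Lam (mulCoord i f) + (d : ℂ) • mulCoord i f := by
    rw [hg, map_add, Lam_mulCoord, map_smul]; module
  have h1 := intBall_mulWeight hd (pderiv i f)
  have h2 := intBall_mulWeight_mulWeight hd (pderiv i g)
  have h3 := intBall_mulWeight_mulWeight_pderiv i k
  have h4 := intBall_mulWeight hd (mulCoord i g)
  have h5 := intBall_Lam_add hd (mulCoord i f)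
  rw [e1] at h1
  rw [e2, h3, e3, h4, h1, e4, h5] at h2
  have h6 : (8 : ℂ) • intSphere (mulCoord i f) = (8 : ℂ) • intBall (pderiv i f) := by
    linear_combination (norm := module) h2
  exact (smul_right_injective _ (by norm_num : (8 : ℂ) ≠ 0) h6).symm

/-! ### Dissipativity of the free generator -/

namespace IsHermForm

variable {F : Type*} [AddCommGroup F] [Module ℂ F] {B : F → F → ℂ}

/-- The form as a linear functional of its first argument. -/
def toLin (hB : IsHermForm B) (g : F) : F →ₗ[ℂ] ℂ where
  toFun f := B f g
  map_add' f h := hB.add f h g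
  map_smul' c f := hB.smul c f g

theorem neg_left (hB : IsHermForm B) (f g : F) : B (-f) g = -B f g := (hB.toLin g).map_neg f

theorem sub_left (hB : IsHermForm B) (f g h : F) : B (f - g) h = B f h - B g h :=
  (hB.toLin h).map_sub f g

theorem sum_left (hB : IsHermForm B) {ι : Type*} (s : Finset ι) (f : ι → F) (g : F) :
    B (∑ i ∈ s, f i) g = ∑ i ∈ s, B (f i) g := map_sum (hB.toLin g) f s

theorem add_right (hB : IsHermForm B) (f g h : F) : B f (g + h) = B f g + B f h := by
  rw [← hB.symm, hB.add, map_add, hB.symm, hB.symm]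

theorem sub_right (hB : IsHermForm B) (f g h : F) : B f (g - h) = B f g - B f h := by
  rw [← hB.symm, hB.sub_left, map_sub, hB.symm, hB.symm]

theorem sum_right (hB : IsHermForm B) {ι : Type*} (s : Finset ι) (f : F) (g : ι → F) :
    B f (∑ i ∈ s, g i) = ∑ i ∈ s, B f (g i) := by
  rw [← hB.symm, hB.sum_left, map_sum]
  simp only [hB.symm]

theorem re_symm (hB : IsHermForm B) (f g : F) : (B f g).re = (B g f).re := by
  rw [← hB.symm f g, Complex.conj_re]

end IsHermForm

theorem ipBall_eq_intBall (f g : SmoothBall d m) : ipBall f g = intBall (pairing f g) 0 := by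
  rw [ipBall_eq, ← setIntegral_ball]
  have h : ∫ x in ball (0 : Sp d) 1, (pairing f g : Sp d → Tgt 1) x 0 =
      (∫ x in ball (0 : Sp d) 1, (pairing f g : Sp d → Tgt 1) x) 0 :=
    (EuclideanSpace.proj (𝕜 := ℂ) (0 : Fin 1)).integral_comp_comm
      (smooth_integrable (pairing f g)).integrableOn
  simpa only [pairing_apply] using h

theorem ipSphere_eq_intSphere (f g : SmoothBall d m) :
    ipSphere f g = intSphere (pairing f g) 0 := by
  rw [ipSphere_eq]
  have h : ∫ y : sphere (0 : Sp d) 1, (pairing f g : Sp d → Tgt 1) y 0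
      ∂(volume : Measure (Sp d)).toSphere = intSphere (pairing f g) 0 :=
    (EuclideanSpace.proj (𝕜 := ℂ) (0 : Fin 1)).integral_comp_comm
      (integrable_sphere_restrict (pairing f g))
  simpa only [pairing_apply] using h

theorem mulCoord_pairing (i : Fin d) (f g : SmoothBall d m) :
    mulCoord i (pairing f g) = pairing (mulCoord i f) g := by
  refine SmoothBall.ext_closedBall fun x hx => ?_
  ext j
  rw [Fin.fin_one_eq_zero j, pairing_apply, mulCoord_apply, mulCoord_apply, PiLp.smul_apply,
    pairing_apply, ← Complex.coe_smul, ← Complex.coe_smul, inner_smul_right, smul_eq_mul]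

theorem mulCoord_pairing_right (i : Fin d) (f g : SmoothBall d m) :
    mulCoord i (pairing f g) = pairing f (mulCoord i g) := by
  refine SmoothBall.ext_closedBall fun x hx => ?_
  ext j
  rw [Fin.fin_one_eq_zero j, pairing_apply, mulCoord_apply, mulCoord_apply, PiLp.smul_apply,
    pairing_apply, ← Complex.coe_smul, ← Complex.coe_smul, inner_smul_left, smul_eq_mul,
    Complex.conj_ofReal]

/-- Integration by parts on the ball. -/
theorem ipBall_pderiv_add (i : Fin d) (f g : SmoothBall d m) :
    ipBall (pderiv i f) g + ipBall f (pderiv i g) = ipSphere (mulCoord i f) g := by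
  rw [ipBall_eq_intBall, ipBall_eq_intBall, ipSphere_eq_intSphere, ← mulCoord_pairing,
    ← intBall_pderiv, pderiv_pairing, map_add]
  rfl

theorem ipSphere_mulWeight (f g : SmoothBall d m) : ipSphere (mulWeight f) g = 0 := by
  rw [ipSphere_eq]
  refine integral_eq_zero_of_ae (Eventually.of_forall fun y => ?_)
  simp only [mulWeight_apply, mem_sphere_zero_iff_norm.1 y.2]
  simp

/-- The formal adjoint of `Λ` is `-Λ - d`, up to a boundary term. -/
theorem ipBall_Lam_add (f g : SmoothBall d m) :
    ipBall (Lam f) g + ipBall f (Lam g) = ipSphere f g - d * ipBall f g := by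
  have hB := isHermForm_ipBall (d := d) (m := m)
  have hS := isHermForm_ipSphere (d := d) (m := m)
  have h1 : ∀ i, ipBall (mulCoord i (pderiv i f)) g + ipBall f g +
      ipBall f (mulCoord i (pderiv i g)) = ipSphere (mulCoord i (mulCoord i f)) g := by
    intro i
    rw [← ipBall_pderiv_add, pderiv_mulCoord, if_pos rfl, hB.add]
    congr 1
    rw [ipBall_eq_intBall, ipBall_eq_intBall, ← mulCoord_pairing, mulCoord_pairing_right]
  have h2 : ipSphere f g = ∑ i, ipSphere (mulCoord i (mulCoord i f)) g := by
    rw [← hS.sum_left, ← sub_eq_zero, ← hS.sub_left, ← mulWeight_eq, ipSphere_mulWeight]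
  rw [h2, Lam_eq_sum, Lam_eq_sum, hB.sum_left, hB.sum_right]
  simp only [← h1, Finset.sum_add_distrib]
  simp
  ring

/-- On the sphere the radial derivative is dominated by the full gradient. -/
theorem ipSphere_Lam_le (f : SmoothBall d m) :
    (ipSphere (Lam f) (Lam f)).re ≤ ∑ i, (ipSphere (pderiv i f) (pderiv i f)).re := by
  have hre : ∀ g : SmoothBall d m, (ipSphere g g).re = ∫ y : sphere (0 : Sp d) 1,
      ‖(g : Sp d → Tgt m) y‖ ^ 2 ∂(volume : Measure (Sp d)).toSphere := fun g => by
    rw [ipSphere_eq, ← RCLike.re_eq_complex_re, ← integral_re (𝕜 := ℂ) (integrable_sphere g g)]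
    simp only [inner_self_eq_norm_sq]
  have hint : ∀ g : SmoothBall d m, Integrable (fun y : sphere (0 : Sp d) 1 =>
      ‖(g : Sp d → Tgt m) y‖ ^ 2) (volume : Measure (Sp d)).toSphere := fun g =>
    ((smooth_continuous_sphere g).norm.pow 2).integrable_of_hasCompactSupport
      (HasCompactSupport.of_compactSpace _)
  simp only [hre]
  rw [← integral_finsetSum _ fun i _ => hint _]
  refine integral_mono (hint _) (integrable_finsetSum _ fun i _ => hint _) fun y => ?_
  have hy : ∑ i, ‖(y : Sp d) i‖ ^ 2 = 1 := by
    rw [← EuclideanSpace.norm_sq_eq, mem_sphere_zero_iff_norm.1 y.2, one_pow]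
  have h1 : ‖(Lam f : Sp d → Tgt m) y‖ ≤
      ∑ i, ‖(y : Sp d) i‖ * ‖(pderiv i f : Sp d → Tgt m) y‖ := by
    rw [Lam_apply, fderivWithin_apply_eq_sum]
    refine (norm_sum_le _ _).trans (le_of_eq ?_)
    simp only [norm_smul]
  have h2 := Finset.sum_mul_sq_le_sq_mul_sq Finset.univ (fun i => ‖(y : Sp d) i‖)
    (fun i => ‖(pderiv i f : Sp d → Tgt m) y‖)
  rw [hy, one_mul] at h2
  exact (pow_le_pow_left₀ (norm_nonneg _) h1 2).trans h2

/-- The energy estimate in `𝓗¹`.  Integrating by parts leaves, besides `d/2 - 1` times the energy in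
the ball, the boundary integrand
`-½ |∇u|² - ½ |v|² + Re (Λu · v) - Re (Λu · u) + Re (v · u) ≤ ½ |u|² - ½ |Λu - v + u|²`, and
`½ ≤ d/2 - 1`. -/
theorem re_ipOne_freeOp_le (hd : 3 ≤ d) (f : SmoothBall d m × SmoothBall d m) :
    (ipOne (freeOp f) f).re ≤ ((d : ℝ) / 2 - 1) * (ipOne f f).re := by
  obtain ⟨u, v⟩ := f
  have hB := isHermForm_ipBall (d := d) (m := m)
  have hS := isHermForm_ipSphere (d := d) (m := m)
  have hrad : ∀ w : SmoothBall d m, (ipBall (Lam w) w).re =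
      (ipSphere w w).re / 2 - d / 2 * (ipBall w w).re := fun w => by
    have h1 := congrArg Complex.re (ipBall_Lam_add w w)
    rw [Complex.add_re, hB.re_symm w (Lam w), Complex.sub_re, ← Complex.ofReal_natCast,
      Complex.re_ofReal_mul] at h1
    linarith
  have hgreen : ∑ i, (ipBall (pderiv i (pderiv i u)) v).re +
      ∑ i, (ipBall (pderiv i v) (pderiv i u)).re = (ipSphere (Lam u) v).re := by
    rw [Lam_eq_sum, hS.sum_left, Complex.re_sum, ← Finset.sum_add_distrib]
    refine Finset.sum_congr rfl fun i _ => ?_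
    rw [hB.re_symm (pderiv i v), ← Complex.add_re, ipBall_pderiv_add]
  have hcs := ipSphere_Lam_le u
  have hsq := hS.nonneg (Lam u - v + u)
  simp only [hS.add, hS.sub_left, hS.add_right, hS.sub_right, Complex.add_re, Complex.sub_re] at hsq
  rw [hS.re_symm v (Lam u), hS.re_symm u (Lam u), hS.re_symm u v] at hsq
  have hu := hS.nonneg u
  have hd' : (3 : ℝ) ≤ d := by exact_mod_cast hd
  simp only [ipOne, freeOp_apply, map_add, map_neg, pderiv_Lam, hB.add, hB.neg_left, hB.sub_left,
    hS.add, hS.neg_left, Lap_eq_sum, hB.sum_left, Complex.add_re, Complex.neg_re, Complex.sub_re,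
    Complex.re_sum, Finset.sum_add_distrib, neg_add, hrad, Finset.sum_neg_distrib,
    Finset.sum_sub_distrib, ← Finset.mul_sum, ← Finset.sum_div]
  nlinarith

theorem re_ipHom_freeOp_le (hd : 3 ≤ d) (n : ℕ) (f : SmoothBall d m × SmoothBall d m) :
    (ipHom n (freeOp f) f).re ≤ ((d : ℝ) / 2 - 1) * (ipHom n f f).re := by
  induction n generalizing f with
  | zero => exact re_ipOne_freeOp_le hd f
  | succ n ih =>
    have hH := isHermForm_ipHom (d := d) (m := m) n
    simp only [ipHom, pairDeriv_freeOp, hH.sub_left, Complex.re_sum, Complex.sub_re, Finset.mul_sum]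
    refine Finset.sum_le_sum fun i _ => ?_
    linarith [ih (pairDeriv i f), hH.nonneg (pairDeriv i f)]

/-- `L̃ - (d/2 - 1)` is dissipative in `𝓗^k`. -/
theorem re_ipH_freeOp_le (hd : 3 ≤ d) (k : ℕ) (f : SmoothBall d m × SmoothBall d m) :
    (ipH k (freeOp f) f).re ≤ ((d : ℝ) / 2 - 1) * (ipH k f f).re := by
  unfold ipH
  split_ifs
  · exact re_ipOne_freeOp_le hd f
  · rw [Complex.add_re, Complex.add_re, mul_add]
    exact add_le_add (re_ipHom_freeOp_le hd _ f) (re_ipOne_freeOp_le hd f)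

/-! ### Polynomials -/

/-- The `ℂ^m`-valued polynomial functions on the closed ball of degree less than `n`, described as
the smooth functions all of whose `n`-th partial derivatives vanish. -/
def polyLT (d m : ℕ) : ℕ → Submodule ℂ (SmoothBall d m)
  | 0 => ⊥
  | n + 1 => ⨅ i, (polyLT d m n).comap (pderiv i)

theorem mem_polyLT_succ {n : ℕ} {f : SmoothBall d m} :
    f ∈ polyLT d m (n + 1) ↔ ∀ i, pderiv i f ∈ polyLT d m n := by
  simp [polyLT]

theorem polyLT_mono : Monotone (polyLT d m) := by
  refine monotone_nat_of_le_succ fun n => ?_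
  induction n with
  | zero => exact bot_le
  | succ n ih => exact fun f hf => mem_polyLT_succ.2 fun i => ih (mem_polyLT_succ.1 hf i)

theorem pderiv_mem_polyLT {n : ℕ} {f : SmoothBall d m} (hf : f ∈ polyLT d m n) (i : Fin d) :
    pderiv i f ∈ polyLT d m n :=
  mem_polyLT_succ.1 (polyLT_mono n.le_succ hf) i

theorem mulCoord_mem_polyLT {n : ℕ} {f : SmoothBall d m} (hf : f ∈ polyLT d m n) (i : Fin d) :
    mulCoord i f ∈ polyLT d m (n + 1) := by
  induction n generalizing f with
  | zero =>
    obtain rfl : f = 0 := hf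
    simp
  | succ n ih =>
    refine mem_polyLT_succ.2 fun j => ?_
    rw [pderiv_mulCoord]
    refine add_mem (ih (mem_polyLT_succ.1 hf j)) ?_
    split_ifs
    · exact hf
    · exact zero_mem _

theorem Lam_mem_polyLT {n : ℕ} {f : SmoothBall d m} (hf : f ∈ polyLT d m n) :
    Lam f ∈ polyLT d m n := by
  cases n with
  | zero =>
    obtain rfl : f = 0 := hf
    simp
  | succ n =>
    rw [Lam_eq_sum]
    exact sum_mem fun j _ => mulCoord_mem_polyLT (mem_polyLT_succ.1 hf j) j

theorem Lap_mem_polyLT {n : ℕ} {f : SmoothBall d m} (hf : f ∈ polyLT d m n) :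
    Lap f ∈ polyLT d m n := by
  rw [Lap_eq_sum]
  exact sum_mem fun j _ => pderiv_mem_polyLT (pderiv_mem_polyLT hf j) j

theorem freeOp_mem_polyLT {n : ℕ} {f : SmoothBall d m × SmoothBall d m}
    (hf : f ∈ (polyLT d m n).prod (polyLT d m n)) :
    freeOp f ∈ (polyLT d m n).prod (polyLT d m n) :=
  ⟨add_mem (neg_mem (Lam_mem_polyLT hf.1)) hf.2,
    sub_mem (sub_mem (Lap_mem_polyLT hf.1) (Lam_mem_polyLT hf.2)) hf.2⟩

theorem eqOn_const_of_pderiv_eq_zero {f : SmoothBall d m} (h : ∀ i, pderiv i f = 0) {x : Sp d}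
    (hx : x ∈ closedBall (0 : Sp d) 1) : (f : Sp d → Tgt m) x = (f : Sp d → Tgt m) 0 := by
  refine (convex_closedBall (0 : Sp d) 1).is_const_of_fderivWithin_eq_zero (𝕜 := ℝ)
    (smooth_differentiableOn f) (fun y _ => ?_) hx (mem_closedBall_self zero_le_one)
  ext v : 1
  rw [fderivWithin_apply_eq_sum]
  simp [h]

/-- A space on which `f` is determined by `e f` and the `D i f` is finite-dimensional if these take
their values in finite-dimensional spaces. -/
theorem finiteDimensional_of_eval_of_deriv {M E ι : Type*} [AddCommGroup M] [Module ℂ M]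
    [AddCommGroup E] [Module ℂ E] [FiniteDimensional ℂ E] [Finite ι] (P Q : Submodule ℂ M)
    [FiniteDimensional ℂ P] (e : M →ₗ[ℂ] E) (D : ι → M →ₗ[ℂ] M)
    (hD : ∀ i, ∀ f ∈ Q, D i f ∈ P) (h0 : ∀ f ∈ Q, e f = 0 → (∀ i, D i f = 0) → f = 0) :
    FiniteDimensional ℂ Q := by
  let T : Q →ₗ[ℂ] E × (ι → P) := LinearMap.prod (e ∘ₗ Q.subtype)
    (LinearMap.pi fun i => (D i).restrict (hD i))
  refine FiniteDimensional.of_injective T ((injective_iff_map_eq_zero T).2 fun f hf => ?_)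
  refine Subtype.ext (h0 f f.2 (congrArg Prod.fst hf) fun i => ?_)
  exact congrArg Subtype.val (congrFun (congrArg Prod.snd hf) i)

/-- Evaluation at the centre of the ball. -/
def evalZero : SmoothBall d m →ₗ[ℂ] Tgt m where
  toFun f := (f : Sp d → Tgt m) 0
  map_add' _ _ := rfl
  map_smul' _ _ := rfl

instance finiteDimensional_polyLT (n : ℕ) : FiniteDimensional ℂ (polyLT d m n) := by
  induction n with
  | zero => exact inferInstanceAs (FiniteDimensional ℂ (⊥ : Submodule ℂ (SmoothBall d m)))
  | succ n ih =>
    -- A polynomial is determined by its value at `0` and its first derivatives.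
    refine finiteDimensional_of_eval_of_deriv (polyLT d m n) (polyLT d m (n + 1)) evalZero pderiv
      (fun i f hf => mem_polyLT_succ.1 hf i) fun f _ h1 h2 => ?_
    refine SmoothBall.ext_closedBall fun x hx => ?_
    rw [eqOn_const_of_pderiv_eq_zero h2 hx]
    exact h1

/-! ### The `C^N` norms -/

/-- Restriction of a smooth function to the closed ball as a continuous function. -/
def toContinuousMap : SmoothBall d m →ₗ[ℂ] C(closedBall (0 : Sp d) 1, Tgt m) where
  toFun f := ⟨fun x => (f : Sp d → Tgt m) x, (smooth_continuousOn f).domRestrict⟩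
  map_add' _ _ := rfl
  map_smul' _ _ := rfl

/-- The norm of `C^N` of the closed ball: the sum over all tuples of at most `N` indices of the
supremum norms of the iterated partial derivatives. -/
def cnorm : ℕ → Seminorm ℂ (SmoothBall d m)
  | 0 => (normSeminorm ℂ C(closedBall (0 : Sp d) 1, Tgt m)).comp toContinuousMap
  | n + 1 => cnorm 0 + ∑ i, (cnorm n).comp (pderiv i)

theorem cnorm_zero_eq (f : SmoothBall d m) : cnorm 0 f = ‖toContinuousMap f‖ := by
  rw [cnorm]
  rfl

theorem cnorm_succ (n : ℕ) (f : SmoothBall d m) :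
    cnorm (n + 1) f = cnorm 0 f + ∑ i, cnorm n (pderiv i f) := by
  have h : (cnorm (n + 1) : Seminorm ℂ (SmoothBall d m)) =
      cnorm 0 + ∑ i, (cnorm n).comp (pderiv i) := by
    conv_lhs => rw [cnorm]
  rw [h, add_apply, _root_.sum_apply]
  rfl

theorem norm_le_cnorm_zero (f : SmoothBall d m) {x : Sp d} (hx : x ∈ closedBall (0 : Sp d) 1) :
    ‖(f : Sp d → Tgt m) x‖ ≤ cnorm 0 f := by
  rw [cnorm_zero_eq]
  exact (toContinuousMap f).norm_coe_le_norm ⟨x, hx⟩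

theorem cnorm_zero_le {f : SmoothBall d m} {C : ℝ} (hC : 0 ≤ C)
    (h : ∀ x ∈ closedBall (0 : Sp d) 1, ‖(f : Sp d → Tgt m) x‖ ≤ C) : cnorm 0 f ≤ C := by
  rw [cnorm_zero_eq]
  exact (ContinuousMap.norm_le _ hC).2 fun x => h x x.2

theorem cnorm_zero_le_cnorm (n : ℕ) (f : SmoothBall d m) : cnorm 0 f ≤ cnorm n f := by
  cases n with
  | zero => rfl
  | succ n =>
    rw [cnorm_succ]
    exact le_add_of_nonneg_right (Finset.sum_nonneg fun i _ => apply_nonneg _ _)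

theorem cnorm_pderiv_le (n : ℕ) (i : Fin d) (f : SmoothBall d m) :
    cnorm n (pderiv i f) ≤ cnorm (n + 1) f := by
  rw [cnorm_succ]
  have h := Finset.single_le_sum (f := fun i => cnorm n (pderiv i f))
    (fun i _ => apply_nonneg _ _) (Finset.mem_univ i)
  exact h.trans (le_add_of_nonneg_left (apply_nonneg _ _))

theorem cnorm_mono (f : SmoothBall d m) : Monotone fun n => cnorm n f := by
  refine monotone_nat_of_le_succ fun n => ?_
  induction n generalizing f with
  | zero => exact cnorm_zero_le_cnorm 1 f
  | succ n ih =>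
    rw [cnorm_succ, cnorm_succ (n + 1)]
    exact add_le_add le_rfl (Finset.sum_le_sum fun i _ => ih _)

theorem cnorm_zero_mulCoord_le (i : Fin d) (f : SmoothBall d m) :
    cnorm 0 (mulCoord i f) ≤ cnorm 0 f := by
  refine cnorm_zero_le (apply_nonneg _ _) fun x hx => ?_
  rw [mulCoord_apply, norm_smul]
  have h1 : ‖x i‖ ≤ 1 := (PiLp.norm_apply_le x i).trans (mem_closedBall_zero_iff.1 hx)
  exact (mul_le_of_le_one_left (norm_nonneg _) h1).trans (norm_le_cnorm_zero f hx)

theorem exists_cnorm_mulCoord_le (n : ℕ) : ∃ C : ℝ, 0 ≤ C ∧ ∀ (i : Fin d) (f : SmoothBall d m),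
    cnorm n (mulCoord i f) ≤ C * cnorm n f := by
  induction n with
  | zero => exact ⟨1, zero_le_one, fun i f => by simpa using cnorm_zero_mulCoord_le i f⟩
  | succ n ih =>
    obtain ⟨C, hC, h⟩ := ih
    refine ⟨1 + d * (C + 1), by positivity, fun i f => ?_⟩
    have h2 : ∀ j, cnorm n (pderiv j (mulCoord i f)) ≤ (C + 1) * cnorm (n + 1) f := fun j => by
      rw [pderiv_mulCoord, add_mul, one_mul]
      refine (map_add_le_add _ _ _).trans (add_le_add ?_ ?_)
      · exact (h i _).trans (mul_le_mul_of_nonneg_left (cnorm_pderiv_le n j f) hC)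
      · split_ifs
        · exact cnorm_mono f n.le_succ
        · rw [map_zero]; exact apply_nonneg _ _
    rw [cnorm_succ]
    calc cnorm 0 (mulCoord i f) + ∑ j, cnorm n (pderiv j (mulCoord i f))
        ≤ cnorm (n + 1) f + ∑ _j : Fin d, (C + 1) * cnorm (n + 1) f :=
          add_le_add ((cnorm_zero_mulCoord_le i f).trans (cnorm_zero_le_cnorm _ f))
            (Finset.sum_le_sum fun j _ => h2 j)
      _ = (1 + d * (C + 1)) * cnorm (n + 1) f := by simp; ring

theorem exists_cnorm_Lam_le (n : ℕ) : ∃ C : ℝ, 0 ≤ C ∧ ∀ f : SmoothBall d m,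
    cnorm n (Lam f) ≤ C * cnorm (n + 1) f := by
  obtain ⟨C, hC, h⟩ := exists_cnorm_mulCoord_le (d := d) (m := m) n
  refine ⟨d * C, by positivity, fun f => ?_⟩
  rw [Lam_eq_sum]
  calc cnorm n (∑ j, mulCoord j (pderiv j f)) ≤ ∑ j, cnorm n (mulCoord j (pderiv j f)) :=
        Finset.le_sum_of_subadditive _ (map_zero _).le (fun _ _ => map_add_le_add _ _ _) _ _
    _ ≤ ∑ _j : Fin d, C * cnorm (n + 1) f := Finset.sum_le_sum fun j _ =>
        (h j _).trans (mul_le_mul_of_nonneg_left (cnorm_pderiv_le n j f) hC)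
    _ = d * C * cnorm (n + 1) f := by simp; ring

theorem cnorm_Lap_le (n : ℕ) (f : SmoothBall d m) :
    cnorm n (Lap f) ≤ d * cnorm (n + 2) f := by
  rw [Lap_eq_sum]
  calc cnorm n (∑ j, pderiv j (pderiv j f)) ≤ ∑ j, cnorm n (pderiv j (pderiv j f)) :=
        Finset.le_sum_of_subadditive _ (map_zero _).le (fun _ _ => map_add_le_add _ _ _) _ _
    _ ≤ ∑ _j : Fin d, cnorm (n + 2) f := Finset.sum_le_sum fun j _ =>
        (cnorm_pderiv_le n j _).trans (cnorm_pderiv_le (n + 1) j f)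
    _ = d * cnorm (n + 2) f := by simp

/-- The `C^N` norm of a pair. -/
def cnormPair (n : ℕ) (f : SmoothBall d m × SmoothBall d m) : ℝ := cnorm n f.1 + cnorm n f.2

theorem cnormPair_nonneg (n : ℕ) (f : SmoothBall d m × SmoothBall d m) : 0 ≤ cnormPair n f :=
  add_nonneg (apply_nonneg _ _) (apply_nonneg _ _)

theorem cnormPair_mono (f : SmoothBall d m × SmoothBall d m) :
    Monotone fun n => cnormPair n f :=
  fun _ _ h => add_le_add (cnorm_mono f.1 h) (cnorm_mono f.2 h)

theorem cnormPair_pairDeriv_le (n : ℕ) (i : Fin d) (f : SmoothBall d m × SmoothBall d m) :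
    cnormPair n (pairDeriv i f) ≤ cnormPair (n + 1) f :=
  add_le_add (cnorm_pderiv_le n i f.1) (cnorm_pderiv_le n i f.2)

/-- `L̃` loses two derivatives in the `C^N` norms. -/
theorem exists_cnormPair_freeOp_le (n : ℕ) : ∃ C : ℝ, 0 ≤ C ∧
    ∀ f : SmoothBall d m × SmoothBall d m, cnormPair n (freeOp f) ≤ C * cnormPair (n + 2) f := by
  obtain ⟨C, hC, h⟩ := exists_cnorm_Lam_le (d := d) (m := m) n
  refine ⟨C + d + 2, by positivity, fun f => ?_⟩
  have h1 := map_add_le_add (cnorm n) (-Lam f.1) f.2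
  have h2 := map_sub_le_add (cnorm n) (Lap f.1 - Lam f.2) f.2
  have h3 := map_sub_le_add (cnorm n) (Lap f.1) (Lam f.2)
  rw [map_neg_eq_map] at h1
  have h4 : ∀ g : SmoothBall d m, cnorm n g ≤ cnorm (n + 2) g := fun g => cnorm_mono g (by omega)
  have h5 : ∀ g : SmoothBall d m, C * cnorm (n + 1) g ≤ C * cnorm (n + 2) g := fun g =>
    mul_le_mul_of_nonneg_left (cnorm_mono g (by omega)) hC
  have h6 := cnorm_Lap_le n f.1
  have h7 : 0 ≤ cnorm (n + 2) f.1 := apply_nonneg _ _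
  have h9 : 0 ≤ cnorm (n + 2) f.2 := apply_nonneg _ _
  have h8 : 0 ≤ (d : ℝ) * cnorm (n + 2) f.2 := mul_nonneg (by positivity) (apply_nonneg _ _)
  simp only [cnormPair, freeOp_apply]
  linarith [h f.1, h f.2, h4 f.1, h4 f.2, h5 f.1, h5 f.2]

theorem exists_ipBall_le : ∃ C : ℝ, 0 ≤ C ∧ ∀ f : SmoothBall d m,
    (ipBall f f).re ≤ C * cnorm 0 f ^ 2 := by
  refine ⟨volume.real (ball (0 : Sp d) 1), measureReal_nonneg, fun f => ?_⟩
  rw [ipBall_eq, mul_comm]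
  refine (Complex.re_le_norm _).trans (norm_setIntegral_le_of_norm_le_const measure_ball_lt_top
    fun x hx => ?_)
  rw [inner_self_eq_norm_sq_to_K, norm_pow, RCLike.norm_ofReal, abs_norm]
  gcongr
  exact norm_le_cnorm_zero f (ball_subset_closedBall hx)

theorem exists_ipSphere_le : ∃ C : ℝ, 0 ≤ C ∧ ∀ f : SmoothBall d m,
    (ipSphere f f).re ≤ C * cnorm 0 f ^ 2 := by
  refine ⟨(volume : Measure (Sp d)).toSphere.real Set.univ, measureReal_nonneg, fun f => ?_⟩
  rw [ipSphere_eq, mul_comm]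
  refine (Complex.re_le_norm _).trans (norm_integral_le_of_norm_le_const
    (Eventually.of_forall fun y => ?_))
  rw [inner_self_eq_norm_sq_to_K, norm_pow, RCLike.norm_ofReal, abs_norm]
  gcongr
  exact norm_le_cnorm_zero f (sphere_subset_closedBall y.2)

theorem exists_ipOne_le : ∃ C : ℝ, 0 ≤ C ∧ ∀ f : SmoothBall d m × SmoothBall d m,
    (ipOne f f).re ≤ C * cnormPair 1 f ^ 2 := by
  obtain ⟨B, hB, h⟩ := exists_ipBall_le (d := d) (m := m)
  obtain ⟨S, hS, h'⟩ := exists_ipSphere_le (d := d) (m := m)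
  refine ⟨d * B + B + S, by positivity, fun f => ?_⟩
  have hle : ∀ (K : ℝ) (g : SmoothBall d m), 0 ≤ K → cnorm 0 g ≤ cnormPair 1 f →
      K * cnorm 0 g ^ 2 ≤ K * cnormPair 1 f ^ 2 := fun K g hK hg => by
    have : 0 ≤ cnorm 0 g := apply_nonneg _ _
    gcongr
  have h1 : cnorm 1 f.1 ≤ cnormPair 1 f := le_add_of_nonneg_right (apply_nonneg _ _)
  have h2 : cnorm 1 f.2 ≤ cnormPair 1 f := le_add_of_nonneg_left (apply_nonneg _ _)
  have h3 : ∑ i, (ipBall (pderiv i f.1) (pderiv i f.1)).re ≤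
      ∑ _i : Fin d, B * cnormPair 1 f ^ 2 := Finset.sum_le_sum fun i _ =>
    (h _).trans (hle B _ hB ((cnorm_pderiv_le 0 i f.1).trans h1))
  have h4 := (h f.2).trans (hle B _ hB ((cnorm_zero_le_cnorm 1 f.2).trans h2))
  have h5 := (h' f.1).trans (hle S _ hS ((cnorm_zero_le_cnorm 1 f.1).trans h1))
  simp only [ipOne, Complex.add_re, Complex.re_sum]
  simp only [Finset.sum_const, Finset.card_univ, Fintype.card_fin, nsmul_eq_mul] at h3
  linarith

theorem exists_ipHom_le (n : ℕ) : ∃ C : ℝ, 0 ≤ C ∧ ∀ f : SmoothBall d m × SmoothBall d m,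
    (ipHom n f f).re ≤ C * cnormPair (n + 1) f ^ 2 := by
  induction n with
  | zero => exact exists_ipOne_le
  | succ n ih =>
    obtain ⟨C, hC, h⟩ := ih
    refine ⟨d * C, by positivity, fun f => ?_⟩
    have h1 : ∀ i, (ipHom n (pairDeriv i f) (pairDeriv i f)).re ≤
        C * cnormPair (n + 2) f ^ 2 := fun i => by
      refine (h _).trans (mul_le_mul_of_nonneg_left ?_ hC)
      exact pow_le_pow_left₀ (cnormPair_nonneg _ _) (cnormPair_pairDeriv_le _ i f) 2
    simp only [ipHom, Complex.re_sum]
    refine (Finset.sum_le_sum fun i _ => h1 i).trans (le_of_eq ?_)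
    simp
    ring

/-- The norm of `𝓗^k` is dominated by the `C^k` norm. -/
theorem exists_norm_toH_le {k : ℕ} (hk : 1 ≤ k) : ∃ C : ℝ, 0 ≤ C ∧
    ∀ f : SmoothBall d m × SmoothBall d m, ‖toH d m k f‖ ≤ C * cnormPair k f := by
  obtain ⟨C₁, hC₁, h₁⟩ := exists_ipOne_le (d := d) (m := m)
  obtain ⟨C₂, hC₂, h₂⟩ := exists_ipHom_le (d := d) (m := m) (k - 1)
  rw [Nat.sub_add_cancel hk] at h₂
  refine ⟨Real.sqrt (C₁ + C₂), Real.sqrt_nonneg _, fun f => ?_⟩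
  have hn : ‖toH d m k f‖ ^ 2 = (ipH k f f).re := by
    rw [← SmoothPair.norm_sq (k := k) f]
    congr 1
    exact (UniformSpace.Completion.toComplₗᵢ (𝕜 := ℂ) (E := SmoothPair d m k)).norm_map f
  have h3 : (ipOne f f).re ≤ C₁ * cnormPair k f ^ 2 := (h₁ f).trans
    (mul_le_mul_of_nonneg_left (pow_le_pow_left₀ (cnormPair_nonneg _ _) (cnormPair_mono f hk) 2) hC₁)
  have h4 : (ipH k f f).re ≤ (C₁ + C₂) * cnormPair k f ^ 2 := by
    have h5 : 0 ≤ C₂ * cnormPair k f ^ 2 := by positivity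
    unfold ipH
    split_ifs
    · linarith
    · rw [Complex.add_re]
      linarith [h₂ f]
  refine le_of_sq_le_sq ?_ (mul_nonneg (Real.sqrt_nonneg _) (cnormPair_nonneg _ _))
  rw [mul_pow, Real.sq_sqrt (by positivity), hn]
  exact h4

/-! ### Density of the polynomials -/

/-- The restriction of a smooth function on `ℝ^d` to the closed ball. -/
def ofContDiff (g : Sp d → Tgt m) (hg : ContDiff ℝ ∞ g) : SmoothBall d m :=
  ⟨(closedBall 0 1).indicator g,
    hg.contDiffOn.congr fun _ hx => Set.indicator_of_mem hx g,
    fun _ hx => Set.indicator_of_notMem hx g⟩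

theorem ofContDiff_apply {g : Sp d → Tgt m} (hg : ContDiff ℝ ∞ g) {x : Sp d}
    (hx : x ∈ closedBall (0 : Sp d) 1) : (ofContDiff g hg : Sp d → Tgt m) x = g x :=
  Set.indicator_of_mem hx g

theorem contDiff_fderiv_apply {g : Sp d → Tgt m} (hg : ContDiff ℝ ∞ g) (v : Sp d) :
    ContDiff ℝ ∞ fun x => fderiv ℝ g x v :=
  (hg.fderiv_right (m := ∞) (by simp)).clm_apply contDiff_const

theorem pderiv_ofContDiff (i : Fin d) {g : Sp d → Tgt m} (hg : ContDiff ℝ ∞ g) :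
    pderiv i (ofContDiff g hg) = ofContDiff (fun x => fderiv ℝ g x (EuclideanSpace.single i 1))
      (contDiff_fderiv_apply hg _) := by
  refine SmoothBall.ext_closedBall fun x hx => ?_
  have h1 : HasFDerivWithinAt (ofContDiff g hg : Sp d → Tgt m) (fderiv ℝ g x) (closedBall 0 1) x :=
    ((hg.differentiable (by simp)) x).hasFDerivAt.hasFDerivWithinAt.congr
      (fun y hy => ofContDiff_apply hg hy) (ofContDiff_apply hg hx)
  rw [pderiv_eq_of_hasFDerivWithinAt hx h1, ofContDiff_apply _ hx]

theorem smul_mem_closedBall (r : unitInterval) {x : Sp d} (hx : x ∈ closedBall (0 : Sp d) 1) :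
    (r : ℝ) • x ∈ closedBall (0 : Sp d) 1 := by
  rw [mem_closedBall_zero_iff] at hx ⊢
  rw [norm_smul, Real.norm_of_nonneg r.2.1]
  exact mul_le_one₀ r.2.2 (norm_nonneg _) hx

/-- The dilation `x ↦ f (r x)`, for `0 ≤ r ≤ 1`. -/
def dilate (r : unitInterval) (f : SmoothBall d m) : SmoothBall d m :=
  ⟨(closedBall 0 1).indicator fun x => (f : Sp d → Tgt m) ((r : ℝ) • x),
    ((smooth_contDiffOn f).comp (contDiff_const_smul (r : ℝ)).contDiffOn
      fun _ hx => smul_mem_closedBall r hx).congr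
        fun _ hx => Set.indicator_of_mem hx fun x => (f : Sp d → Tgt m) ((r : ℝ) • x),
    fun _ hx => Set.indicator_of_notMem hx _⟩

theorem dilate_apply (r : unitInterval) (f : SmoothBall d m) {x : Sp d}
    (hx : x ∈ closedBall (0 : Sp d) 1) :
    (dilate r f : Sp d → Tgt m) x = (f : Sp d → Tgt m) ((r : ℝ) • x) :=
  Set.indicator_of_mem hx fun x => (f : Sp d → Tgt m) ((r : ℝ) • x)

theorem pderiv_dilate (i : Fin d) (r : unitInterval) (f : SmoothBall d m) :
    pderiv i (dilate r f) = ((r : ℝ) : ℂ) • dilate r (pderiv i f) := by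
  refine SmoothBall.ext_closedBall fun x hx => ?_
  have h1 : HasFDerivWithinAt (fun x : Sp d => (r : ℝ) • x)
      ((r : ℝ) • ContinuousLinearMap.id ℝ (Sp d)) (closedBall 0 1) x :=
    (hasFDerivWithinAt_id x _).const_smul (r : ℝ)
  have h2 := ((smooth_hasFDerivWithinAt f (smul_mem_closedBall r hx)).comp x h1
    (fun y hy => smul_mem_closedBall r hy)).congr (f₁ := (dilate r f : Sp d → Tgt m))
      (fun y hy => dilate_apply r f hy) (dilate_apply r f hx)
  rw [pderiv_eq_of_hasFDerivWithinAt hx h2]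
  change _ = ((r : ℝ) : ℂ) • (dilate r (pderiv i f) : Sp d → Tgt m) x
  rw [dilate_apply r _ hx, pderiv_apply, Complex.coe_smul]
  simp

theorem cnorm_dilate_le (n : ℕ) (r : unitInterval) (f : SmoothBall d m) :
    cnorm n (dilate r f) ≤ cnorm n f := by
  have h0 : ∀ f : SmoothBall d m, cnorm 0 (dilate r f) ≤ cnorm 0 f := fun f =>
    cnorm_zero_le (apply_nonneg _ _) fun x hx => by
      rw [dilate_apply r f hx]
      exact norm_le_cnorm_zero f (smul_mem_closedBall r hx)
  induction n generalizing f with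
  | zero => exact h0 f
  | succ n ih =>
    rw [cnorm_succ, cnorm_succ]
    refine add_le_add (h0 f) (Finset.sum_le_sum fun i _ => ?_)
    rw [pderiv_dilate, map_smul_eq_mul, Complex.norm_real, Real.norm_of_nonneg r.2.1]
    exact (mul_le_of_le_one_left (apply_nonneg _ _) r.2.2).trans (ih _)

theorem tendsto_cnorm_sub_dilate (n : ℕ) (f : SmoothBall d m) :
    Tendsto (fun r => cnorm n (f - dilate r f)) (𝓝 1) (𝓝 0) := by
  have h0 : ∀ f : SmoothBall d m, Tendsto (fun r => cnorm 0 (f - dilate r f)) (𝓝 1) (𝓝 0) := by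
    intro f
    rw [Metric.tendsto_nhds]
    intro ε hε
    have huc := (isCompact_closedBall (0 : Sp d) 1).uniformContinuousOn_of_continuous
      (smooth_continuousOn f)
    obtain ⟨δ, hδ, h⟩ := Metric.uniformContinuousOn_iff.1 huc (ε / 2) (by positivity)
    filter_upwards [Metric.ball_mem_nhds (1 : unitInterval) hδ] with r hr
    rw [Real.dist_eq, sub_zero, abs_of_nonneg (apply_nonneg _ _)]
    refine (cnorm_zero_le (half_pos hε).le fun x hx => ?_).trans_lt (half_lt_self hε)
    change ‖(f : Sp d → Tgt m) x - (dilate r f : Sp d → Tgt m) x‖ ≤ _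
    rw [dilate_apply r f hx, ← dist_eq_norm]
    refine (h x hx _ (smul_mem_closedBall r hx) ?_).le
    have e : x - (r : ℝ) • x = (1 - (r : ℝ)) • x := by rw [sub_smul, one_smul]
    rw [dist_eq_norm, e, norm_smul, Real.norm_eq_abs, abs_sub_comm]
    refine (mul_le_of_le_one_right (abs_nonneg _) (mem_closedBall_zero_iff.1 hx)).trans_lt ?_
    exact hr
  induction n generalizing f with
  | zero => exact h0 f
  | succ n ih =>
    simp only [cnorm_succ]
    have hsum : Tendsto (fun r : unitInterval => ∑ i, cnorm n (pderiv i (f - dilate r f))) (𝓝 1)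
        (𝓝 (∑ _i : Fin d, 0)) := by
      refine tendsto_finsetSum _ fun i _ => ?_
      have h1 : Tendsto (fun r : unitInterval => |1 - (r : ℝ)| * cnorm n (pderiv i f)) (𝓝 1)
          (𝓝 0) := by
        have : Continuous fun r : unitInterval => |1 - (r : ℝ)| * cnorm n (pderiv i f) := by
          fun_prop
        simpa using this.tendsto 1
      have h2 := (ih (pderiv i f)).add h1
      rw [add_zero] at h2
      refine squeeze_zero (fun r => apply_nonneg _ _) (fun r => ?_) h2
      have e : pderiv i (f - dilate r f) = (pderiv i f - dilate r (pderiv i f)) +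
          ((1 - (r : ℝ) : ℝ) : ℂ) • dilate r (pderiv i f) := by
        rw [map_sub, pderiv_dilate, Complex.ofReal_sub, Complex.ofReal_one]
        module
      rw [e]
      refine (map_add_le_add _ _ _).trans (add_le_add le_rfl ?_)
      rw [map_smul_eq_mul, Complex.norm_real, Real.norm_eq_abs]
      exact mul_le_mul_of_nonneg_left (cnorm_dilate_le n r _) (abs_nonneg _)
    simpa using (h0 f).add hsum

variable (d m) in
/-- Smooth compactly supported functions on `ℝ^d`. -/
structure TestFn where
  /-- The underlying function. -/
  toFun : Sp d → Tgt m
  contDiff : ContDiff ℝ ∞ toFun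
  compact : HasCompactSupport toFun

namespace TestFn

/-- The restriction of a test function to the closed ball. -/
def toSmooth (g : TestFn d m) : SmoothBall d m := ofContDiff g.toFun g.contDiff

/-- The partial derivative of a test function. -/
def deriv (i : Fin d) (g : TestFn d m) : TestFn d m where
  toFun x := fderiv ℝ g.toFun x (EuclideanSpace.single i 1)
  contDiff := contDiff_fderiv_apply g.contDiff _
  compact := g.compact.fderiv_apply ℝ _

/-- The product of a test function with a coordinate function. -/
def coordMul (i : Fin d) (g : TestFn d m) : TestFn d m where
  toFun x := x i • g.toFun x
  contDiff := by
    have h : ContDiff ℝ ∞ fun x : Sp d => x i := (EuclideanSpace.proj (𝕜 := ℝ) i).contDiff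
    exact h.smul g.contDiff
  compact := HasCompactSupport.smul_left (f := fun x : Sp d => x i) g.compact

theorem pderiv_toSmooth (i : Fin d) (g : TestFn d m) :
    pderiv i g.toSmooth = (g.deriv i).toSmooth := pderiv_ofContDiff i g.contDiff

/-- The restriction to the closed ball of the convolution `φ ⋆ g`. -/
def conv (φ : C(Sp d, ℝ)) (g : TestFn d m) : SmoothBall d m :=
  ofContDiff (convolution φ g.toFun (ContinuousLinearMap.lsmul ℝ ℝ) volume)
    (g.compact.contDiff_convolution_right _ φ.continuous.locallyIntegrable g.contDiff)

theorem conv_apply (φ : C(Sp d, ℝ)) (g : TestFn d m) {x : Sp d}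
    (hx : x ∈ closedBall (0 : Sp d) 1) :
    (conv φ g : Sp d → Tgt m) x = ∫ t, φ (x - t) • g.toFun t := by
  rw [conv, ofContDiff_apply _ hx, convolution_lsmul_swap]

theorem integrable_smul (φ : C(Sp d, ℝ)) (g : TestFn d m) (x : Sp d) :
    Integrable fun t => φ (x - t) • g.toFun t :=
  ((φ.continuous.comp (by fun_prop)).smul g.contDiff.continuous).integrable_of_hasCompactSupport
    g.compact.smul_left

theorem pderiv_conv (i : Fin d) (φ : C(Sp d, ℝ)) (g : TestFn d m) :
    pderiv i (conv φ g) = conv φ (g.deriv i) := by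
  refine SmoothBall.ext_closedBall fun x hx => ?_
  rw [conv, pderiv_ofContDiff, ofContDiff_apply _ hx, conv, ofContDiff_apply _ hx,
    (g.compact.hasFDerivAt_convolution_right _ φ.continuous.locallyIntegrable
      (g.contDiff.of_le (by simp)) x).fderiv,
    convolution_precompR_apply _ φ.continuous.locallyIntegrable (g.compact.fderiv ℝ)
      (g.contDiff.continuous_fderiv (by simp))]
  rfl

theorem conv_sub (φ ψ : C(Sp d, ℝ)) (g : TestFn d m) :
    conv (φ - ψ) g = conv φ g - conv ψ g := by
  refine SmoothBall.ext_closedBall fun x hx => ?_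
  change _ = (conv φ g : Sp d → Tgt m) x - (conv ψ g : Sp d → Tgt m) x
  rw [conv_apply _ _ hx, conv_apply _ _ hx, conv_apply _ _ hx,
    ← integral_sub (integrable_smul φ g x) (integrable_smul ψ g x)]
  simp only [ContinuousMap.sub_apply, sub_smul]

/-- A convolution is small in all `C^n` norms if the kernel is small on a large ball, since the
derivatives fall on the test function. -/
theorem exists_cnorm_conv_le (n : ℕ) {R : ℝ} (g : TestFn d m)
    (hg : tsupport g.toFun ⊆ closedBall 0 R) :
    ∃ C : ℝ, 0 ≤ C ∧ ∀ (φ : C(Sp d, ℝ)) (M : ℝ), 0 ≤ M →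
      (∀ x ∈ closedBall (0 : Sp d) (R + 1), |φ x| ≤ M) → cnorm n (conv φ g) ≤ C * M := by
  have h0 : ∀ g : TestFn d m, tsupport g.toFun ⊆ closedBall 0 R →
      ∀ (φ : C(Sp d, ℝ)) (M : ℝ), 0 ≤ M → (∀ x ∈ closedBall (0 : Sp d) (R + 1), |φ x| ≤ M) →
        cnorm 0 (conv φ g) ≤ (∫ t, ‖g.toFun t‖) * M := by
    intro g hg φ M hM hφ
    have hint : Integrable g.toFun :=
      g.contDiff.continuous.integrable_of_hasCompactSupport g.compact
    refine cnorm_zero_le (mul_nonneg (integral_nonneg fun _ => norm_nonneg _) hM) fun x hx => ?_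
    rw [conv_apply φ g hx, ← integral_mul_const]
    refine norm_integral_le_of_norm_le (hint.norm.mul_const M) (Eventually.of_forall fun t => ?_)
    rw [norm_smul, mul_comm]
    by_cases ht : t ∈ tsupport g.toFun
    · refine mul_le_mul_of_nonneg_left (hφ _ ?_) (norm_nonneg _)
      have h1 := mem_closedBall_zero_iff.1 (hg ht)
      have h2 := mem_closedBall_zero_iff.1 hx
      rw [mem_closedBall_zero_iff]
      linarith [norm_sub_le x t]
    · rw [image_eq_zero_of_notMem_tsupport ht]
      simp
  induction n generalizing g with
  | zero => exact ⟨_, integral_nonneg fun _ => norm_nonneg _, h0 g hg⟩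
  | succ n ih =>
    have hg' : ∀ i, tsupport (g.deriv i).toFun ⊆ closedBall 0 R := fun i =>
      (tsupport_fderiv_apply_subset ℝ _).trans hg
    choose C hC h using fun i => ih (g.deriv i) (hg' i)
    refine ⟨(∫ t, ‖g.toFun t‖) + ∑ i, C i,
      add_nonneg (integral_nonneg fun _ => norm_nonneg _) (Finset.sum_nonneg fun i _ => hC i),
      fun φ M hM hφ => ?_⟩
    rw [cnorm_succ, add_mul, Finset.sum_mul]
    refine add_le_add (h0 g hg φ M hM hφ) (Finset.sum_le_sum fun i _ => ?_)
    rw [pderiv_conv]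
    exact h i φ M hM hφ

variable (d) in
/-- A sequence of bump functions with supports shrinking to the origin. -/
def bump (n : ℕ) : ContDiffBump (0 : Sp d) where
  rIn := 1 / (2 * (n + 1))
  rOut := 1 / (n + 1)
  rIn_pos := by positivity
  rIn_lt_rOut := by
    apply one_div_lt_one_div_of_lt <;> linarith [(n.cast_nonneg : (0 : ℝ) ≤ n)]

variable (d) in
/-- The normalized bump functions, a sequence of mollifiers. -/
def mollifier (n : ℕ) : C(Sp d, ℝ) := ⟨(bump d n).normed volume, (bump d n).continuous_normed⟩

theorem tendsto_cnorm_sub_conv_mollifier (N : ℕ) (g : TestFn d m) :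
    Tendsto (fun n => cnorm N (g.toSmooth - conv (mollifier d n) g)) atTop (𝓝 0) := by
  have h0 : ∀ g : TestFn d m,
      Tendsto (fun n => cnorm 0 (g.toSmooth - conv (mollifier d n) g)) atTop (𝓝 0) := by
    intro g
    rw [Metric.tendsto_nhds]
    intro ε hε
    have huc := g.compact.uniformContinuous_of_continuous g.contDiff.continuous
    obtain ⟨δ, hδ, h⟩ := Metric.uniformContinuous_iff.1 huc (ε / 2) (by positivity)
    have hev : ∀ᶠ n : ℕ in atTop, 1 / ((n : ℝ) + 1) < δ :=
      tendsto_one_div_add_atTop_nhds_zero_nat.eventually_lt_const hδ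
    filter_upwards [hev] with n hn
    rw [Real.dist_eq, sub_zero, abs_of_nonneg (apply_nonneg _ _)]
    refine (cnorm_zero_le (half_pos hε).le fun x hx => ?_).trans_lt (half_lt_self hε)
    change ‖(g.toSmooth : Sp d → Tgt m) x - (conv (mollifier d n) g : Sp d → Tgt m) x‖ ≤ _
    rw [toSmooth, conv, ofContDiff_apply _ hx, ofContDiff_apply _ hx, ← dist_eq_norm, dist_comm]
    refine ContDiffBump.dist_normed_convolution_le (φ := bump d n)
      g.contDiff.continuous.aestronglyMeasurable fun y hy => (h ?_).le
    exact (mem_ball.1 hy).trans hn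
  induction N generalizing g with
  | zero => exact h0 g
  | succ N ih =>
    simp only [cnorm_succ, map_sub, pderiv_toSmooth, pderiv_conv]
    simpa using (h0 g).add (tendsto_finsetSum Finset.univ fun i _ => ih (g.deriv i))

/-- A real polynomial as a continuous function. -/
def polyFun (p : MvPolynomial (Fin d) ℝ) : C(Sp d, ℝ) where
  toFun x := MvPolynomial.eval (fun i => x i) p
  continuous_toFun := (MvPolynomial.continuous_eval p).comp (by fun_prop)

/-- The convolution of a test function with a polynomial is a polynomial. -/
theorem exists_conv_polyFun_mem (p : MvPolynomial (Fin d) ℝ) (g : TestFn d m) :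
    ∃ n, conv (polyFun p) g ∈ polyLT d m n := by
  induction p using MvPolynomial.induction_on generalizing g with
  | C a =>
    refine ⟨1, mem_polyLT_succ.2 fun i => ?_⟩
    have h : conv (polyFun (MvPolynomial.C a)) g =
        ofContDiff (fun _ => ∫ t, a • g.toFun t) contDiff_const := by
      refine SmoothBall.ext_closedBall fun x hx => ?_
      rw [conv_apply _ _ hx, ofContDiff_apply _ hx]
      simp [polyFun]
    rw [h, pderiv_ofContDiff]
    refine (Submodule.mem_bot ℂ).2 (SmoothBall.ext_closedBall fun x hx => ?_)
    rw [ofContDiff_apply _ hx]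
    simp
  | add p q hp hq =>
    obtain ⟨n₁, h₁⟩ := hp g
    obtain ⟨n₂, h₂⟩ := hq g
    refine ⟨max n₁ n₂, ?_⟩
    have h : conv (polyFun (p + q)) g = conv (polyFun p) g + conv (polyFun q) g := by
      refine SmoothBall.ext_closedBall fun x hx => ?_
      change _ = (conv (polyFun p) g : Sp d → Tgt m) x + (conv (polyFun q) g : Sp d → Tgt m) x
      rw [conv_apply _ _ hx, conv_apply _ _ hx, conv_apply _ _ hx,
        ← integral_add (integrable_smul _ g x) (integrable_smul _ g x)]
      simp [polyFun, add_smul]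
    rw [h]
    exact add_mem (polyLT_mono (le_max_left _ _) h₁) (polyLT_mono (le_max_right _ _) h₂)
  | mul_X p i hp =>
    obtain ⟨n₁, h₁⟩ := hp g
    obtain ⟨n₂, h₂⟩ := hp (g.coordMul i)
    refine ⟨max (n₁ + 1) n₂, ?_⟩
    have h : conv (polyFun (p * MvPolynomial.X i)) g =
        mulCoord i (conv (polyFun p) g) - conv (polyFun p) (g.coordMul i) := by
      refine SmoothBall.ext_closedBall fun x hx => ?_
      change _ = x i • (conv (polyFun p) g : Sp d → Tgt m) x -
        (conv (polyFun p) (g.coordMul i) : Sp d → Tgt m) x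
      have hint : Integrable fun t => x i • polyFun p (x - t) • g.toFun t :=
        (integrable_smul _ g x).smul (x i)
      rw [conv_apply _ _ hx, conv_apply _ _ hx, conv_apply _ _ hx, ← integral_smul,
        ← integral_sub hint (integrable_smul _ (g.coordMul i) x)]
      refine integral_congr_ae (Eventually.of_forall fun t => ?_)
      simp only [polyFun, coordMul, ContinuousMap.coe_mk, map_mul, MvPolynomial.eval_X,
        PiLp.sub_apply]
      module
    rw [h]
    exact sub_mem (polyLT_mono (le_max_left _ _) (mulCoord_mem_polyLT h₁ i))
      (polyLT_mono (le_max_right _ _) h₂)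

end TestFn

/-- The Weierstrass approximation theorem on a ball. -/
theorem exists_polyFun_near (φ : C(Sp d, ℝ)) (R : ℝ) {ε : ℝ} (hε : 0 < ε) :
    ∃ p : MvPolynomial (Fin d) ℝ, ∀ x ∈ closedBall (0 : Sp d) R,
      |φ x - TestFn.polyFun p x| ≤ ε := by
  have : CompactSpace (closedBall (0 : Sp d) R) :=
    isCompact_iff_compactSpace.1 (isCompact_closedBall _ _)
  let X : Fin d → C(closedBall (0 : Sp d) R, ℝ) := fun i => ⟨fun x => (x : Sp d) i, by fun_prop⟩
  have hsep : (MvPolynomial.aeval (R := ℝ) X).range.SeparatesPoints := by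
    intro x y hxy
    have h1 : ∃ i, (x : Sp d) i ≠ (y : Sp d) i := by
      by_contra! h
      exact hxy (Subtype.ext (PiLp.ext h))
    obtain ⟨i, hi⟩ := h1
    exact ⟨X i, ⟨X i, ⟨MvPolynomial.X i, by simp⟩, rfl⟩, hi⟩
  obtain ⟨⟨_, p, rfl⟩, hp⟩ :=
    ContinuousMap.exists_mem_subalgebra_near_continuousMap_of_separatesPoints _ hsep
      (φ.restrict (closedBall 0 R)) ε hε
  refine ⟨p, fun x hx => ?_⟩
  have h2 : ∀ (q : MvPolynomial (Fin d) ℝ) (x : closedBall (0 : Sp d) R),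
      (MvPolynomial.aeval X q : C(closedBall (0 : Sp d) R, ℝ)) x = TestFn.polyFun q x := by
    intro q x
    induction q using MvPolynomial.induction_on with
    | C a => simp [TestFn.polyFun]
    | add p q hp hq => simp_all [TestFn.polyFun]
    | mul_X p i hp => simp_all [TestFn.polyFun, X]
  have h3 := (ContinuousMap.norm_coe_le_norm _ ⟨x, hx⟩).trans hp.le
  rw [abs_sub_comm, ← Real.norm_eq_abs, ← h2 p ⟨x, hx⟩]
  exact h3

/-- For `r < 1` the dilation `x ↦ f (r x)` extends to a test function. -/
theorem exists_testFn_eq_dilate (f : SmoothBall d m) {r : unitInterval} (hr : r < 1) :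
    ∃ g : TestFn d m, g.toSmooth = dilate r f := by
  have hr1 : (r : ℝ) < 1 := hr
  have hr0 : (0 : ℝ) ≤ r := r.2.1
  -- A cutoff equal to `1` on the unit ball, with support inside the ball of radius `1 / r`.
  let χ : ContDiffBump (0 : Sp d) :=
    { rIn := 1
      rOut := 2 / (1 + r)
      rIn_pos := one_pos
      rIn_lt_rOut := by rw [lt_div_iff₀ (by positivity)]; linarith }
  have hc : ContDiff ℝ ∞ fun x : Sp d => χ x • (f : Sp d → Tgt m) ((r : ℝ) • x) := by
    refine contDiff_iff_contDiffAt.2 fun x => ?_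
    by_cases hx : ‖(r : ℝ) • x‖ < 1
    · refine χ.contDiffAt.smul (ContDiffAt.comp x ?_ (contDiff_const_smul (r : ℝ)).contDiffAt)
      exact (smooth_contDiffOn f).contDiffAt (mem_of_superset
        (isOpen_ball.mem_nhds (mem_ball_zero_iff.2 hx)) ball_subset_closedBall)
    · have hx' : x ∉ tsupport (χ : Sp d → ℝ) := by
        rw [χ.tsupport_eq, mem_closedBall_zero_iff, not_le]
        change 2 / (1 + (r : ℝ)) < ‖x‖
        rw [div_lt_iff₀ (by positivity)]
        rw [norm_smul, Real.norm_of_nonneg hr0, not_lt] at hx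
        nlinarith [norm_nonneg x]
      refine (contDiffAt_const (c := (0 : Tgt m))).congr_of_eventuallyEq ?_
      filter_upwards [(isClosed_tsupport _).isOpen_compl.mem_nhds hx'] with y hy
      rw [image_eq_zero_of_notMem_tsupport hy, zero_smul]
  refine ⟨⟨_, hc, χ.hasCompactSupport.smul_right⟩, SmoothBall.ext_closedBall fun x hx => ?_⟩
  rw [TestFn.toSmooth, ofContDiff_apply _ hx, dilate_apply r f hx]
  change χ x • _ = _
  rw [χ.one_of_mem_closedBall hx, one_smul]

/-- Polynomials are dense in every `C^N` norm: dilate, cut off, mollify, and replace the mollifier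
by a polynomial that is uniformly close to it. -/
theorem exists_polyLT_cnorm_sub_lt (N : ℕ) (f : SmoothBall d m) {ε : ℝ} (hε : 0 < ε) :
    ∃ n, ∃ p ∈ polyLT d m n, cnorm N (f - p) < ε := by
  obtain ⟨r, hr, hr1⟩ : ∃ r : unitInterval, cnorm N (f - dilate r f) < ε / 3 ∧ r < 1 := by
    have h1 := (tendsto_cnorm_sub_dilate N f).eventually_lt_const
      (show (0 : ℝ) < ε / 3 by positivity)
    have : (𝓝[<] (1 : unitInterval)).NeBot := nhdsLT_neBot_of_exists_lt ⟨0, zero_lt_one⟩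
    have h2 : ∀ᶠ r in 𝓝[<] (1 : unitInterval), r < 1 := self_mem_nhdsWithin
    exact ((h1.filter_mono nhdsWithin_le_nhds).and h2).exists
  obtain ⟨g, hg⟩ := exists_testFn_eq_dilate f hr1
  obtain ⟨n, hn⟩ := ((g.tendsto_cnorm_sub_conv_mollifier N).eventually_lt_const
      (show (0 : ℝ) < ε / 3 by positivity)).exists
  obtain ⟨R, hR⟩ := g.compact.isBounded.subset_closedBall (0 : Sp d)
  obtain ⟨C, hC, h⟩ := g.exists_cnorm_conv_le N hR
  obtain ⟨p, hp⟩ := exists_polyFun_near (TestFn.mollifier d n) (R + 1)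
    (ε := ε / (3 * (C + 1))) (by positivity)
  obtain ⟨k, hk⟩ := g.exists_conv_polyFun_mem p
  refine ⟨k, _, hk, ?_⟩
  have h1 := h (TestFn.mollifier d n - TestFn.polyFun p) _ (by positivity) hp
  rw [TestFn.conv_sub] at h1
  have h2 : C * (ε / (3 * (C + 1))) < ε / 3 := by
    rw [mul_div_assoc', div_lt_div_iff₀ (by positivity) (by positivity)]
    nlinarith
  have e : f - g.conv (TestFn.polyFun p) = (f - dilate r f) +
      (g.toSmooth - g.conv (TestFn.mollifier d n)) +
      (g.conv (TestFn.mollifier d n) - g.conv (TestFn.polyFun p)) := by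
    rw [hg]; abel
  rw [e]
  have h3 := map_add_le_add (cnorm N) ((f - dilate r f) +
      (g.toSmooth - g.conv (TestFn.mollifier d n)))
      (g.conv (TestFn.mollifier d n) - g.conv (TestFn.polyFun p))
  have h4 := map_add_le_add (cnorm N) (f - dilate r f)
      (g.toSmooth - g.conv (TestFn.mollifier d n))
  linarith

/-! ### The free semigroup -/

theorem inner_toH (k : ℕ) (f g : SmoothPair d m k) :
    inner ℂ (toH d m k f) (toH d m k g) = ipH k g f :=
  (UniformSpace.Completion.toComplₗᵢ (𝕜 := ℂ) (E := SmoothPair d m k)).inner_map_map f g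

theorem norm_toH_sq (k : ℕ) (f : SmoothPair d m k) : ‖toH d m k f‖ ^ 2 = (ipH k f f).re := by
  rw [← inner_toH]
  exact InnerProductSpace.norm_sq_eq_re_inner (𝕜 := ℂ) (toH d m k f)

theorem finiteDimensional_map_prod {M N : Type*} [AddCommGroup M] [Module ℂ M] [AddCommGroup N]
    [Module ℂ N] (P Q : Submodule ℂ M) (hP : FiniteDimensional ℂ P) (hQ : FiniteDimensional ℂ Q)
    (T : (M × M) →ₗ[ℂ] N) : FiniteDimensional ℂ ((P.prod Q).map T) :=
  Module.Finite.iff_fg.2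
    (((Module.Finite.iff_fg.1 hP).prod (Module.Finite.iff_fg.1 hQ)).map T)

variable (d m) in
/-- Pairs of polynomials of degree less than `n`, as elements of `𝓗^k`. -/
def polyH (k n : ℕ) : Submodule ℂ (HSpace d m k) :=
  Submodule.map (toH d m k)
    ((polyLT d m n).prod (polyLT d m n) : Submodule ℂ (SmoothBall d m × SmoothBall d m))

instance finiteDimensional_polyH (k n : ℕ) : FiniteDimensional ℂ (polyH d m k n) :=
  finiteDimensional_map_prod (M := SmoothBall d m) (polyLT d m n) (polyLT d m n)
    (finiteDimensional_polyLT n) (finiteDimensional_polyLT n) (toH d m k)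

theorem polyH_mono (k : ℕ) : Monotone (polyH d m k) := fun _ _ h =>
  Submodule.map_mono (Submodule.prod_mono (polyLT_mono h) (polyLT_mono h))

/-- Every pair of smooth functions is approximated by pairs of polynomials, in the graph norm of
`L̃`: a pair close in the `C^(k+2)` norm is close in `𝓗^k` together with its image under `L̃`. -/
theorem exists_polyH_near {k : ℕ} (hk : 1 ≤ k) (f : SmoothPair d m k) {ε : ℝ} (hε : 0 < ε) :
    ∃ p : SmoothPair d m k, (∃ n, toH d m k p ∈ polyH d m k n) ∧
      ‖toH d m k f - toH d m k p‖ < ε ∧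
      ‖toH d m k (freeOpPair d m k f) - toH d m k (freeOpPair d m k p)‖ < ε := by
  obtain ⟨C, hC, h⟩ := exists_norm_toH_le (d := d) (m := m) hk
  obtain ⟨C', hC', h'⟩ := exists_cnormPair_freeOp_le (d := d) (m := m) k
  set η := ε / (2 * (C * (C' + 1) + 1)) with hη
  have hη0 : 0 < η := by positivity
  obtain ⟨n₁, p₁, hp₁, h₁⟩ := exists_polyLT_cnorm_sub_lt (k + 2) f.1 hη0
  obtain ⟨n₂, p₂, hp₂, h₂⟩ := exists_polyLT_cnorm_sub_lt (k + 2) f.2 hη0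
  have aux : ∀ f' : SmoothBall d m × SmoothBall d m, ∃ q, q = f' - (p₁, p₂) ∧
      freeOp q = freeOp f' - freeOp (p₁, p₂) := fun _ => ⟨_, rfl, map_sub _ _ _⟩
  obtain ⟨q, hq, hLq⟩ := aux f
  have hq2 : cnormPair (k + 2) q < 2 * η := by
    have : cnormPair (k + 2) q = cnorm (k + 2) (f.1 - p₁) + cnorm (k + 2) (f.2 - p₂) := by
      rw [hq]; rfl
    linarith
  have hqk : cnormPair k q ≤ cnormPair (k + 2) q := cnormPair_mono q (by omega)
  have hlt : C * (C' + 1) * cnormPair (k + 2) q < ε := by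
    have h3 : (C * (C' + 1) + 1) * (2 * η) = ε := by rw [hη]; field_simp
    have h4 : C * (C' + 1) * cnormPair (k + 2) q ≤ C * (C' + 1) * (2 * η) := by gcongr
    nlinarith
  have hpos : 0 ≤ cnormPair (k + 2) q := cnormPair_nonneg _ _
  refine ⟨(p₁, p₂), ⟨max n₁ n₂, (p₁, p₂), ⟨polyLT_mono (le_max_left _ _) hp₁,
    polyLT_mono (le_max_right _ _) hp₂⟩, rfl⟩, ?_, ?_⟩
  · have e : toH d m k f - toH d m k (p₁, p₂) = toH d m k q := by
      rw [hq]; exact (map_sub (toH d m k) f (p₁, p₂)).symm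
    rw [e]
    refine (h q).trans_lt (lt_of_le_of_lt ?_ hlt)
    rw [mul_assoc]
    refine mul_le_mul_of_nonneg_left (hqk.trans ?_) hC
    exact le_mul_of_one_le_left hpos (by linarith)
  · have e : toH d m k (freeOpPair d m k f) - toH d m k (freeOpPair d m k (p₁, p₂)) =
        toH d m k (freeOp q) := by
      rw [hLq]; exact (map_sub (toH d m k) _ _).symm
    rw [e]
    refine (h _).trans_lt (lt_of_le_of_lt ?_ hlt)
    rw [mul_assoc]
    refine mul_le_mul_of_nonneg_left ((h' q).trans ?_) hC
    exact mul_le_mul_of_nonneg_right (by linarith) hpos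

end FreeWave

end

open FreeWave in
theorem proposition2p2 (d m k : ℕ) (hd : 3 ≤ d) (hm : 1 ≤ m) (hk : 1 ≤ k) :
    (freeGenerator d m k (by omega)).IsClosable ∧
      ∃ S : ℝ≥0 → HSpace d m k →L[ℂ] HSpace d m k,
        IsC0Semigroup S ∧
        IsGeneratorOf (freeGenerator d m k (by omega)).closure S ∧
        ∀ (τ : ℝ≥0) (f : HSpace d m k), ‖S τ f‖ ≤ Real.exp (((d : ℝ) / 2 - 1) * τ) * ‖f‖ := by
  have hd0 : 0 < d := by omega
  have hd' : (3 : ℝ) ≤ d := by exact_mod_cast hd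
  have happly : ∀ (f : SmoothPair d m k) (x : (freeGenerator d m k hd0).domain),
      toH d m k f = x → freeGenerator d m k hd0 x = toH d m k (freeOpPair d m k f) := by
    intro f x hx
    obtain ⟨g, hg, hg'⟩ := (mem_graph_freeGenerator hd0 _ _).1
      ((freeGenerator d m k hd0).mem_graph x)
    rw [← hg', toH_injective hd0 (hg.trans hx.symm)]
  refine exists_semigroup_of_invariant_finiteDimensional (by linarith) (freeGenerator d m k hd0)
    (polyH d m k) (polyH_mono k) ?_ ?_ ?_ ?_ ?_
  · refine Metric.dense_iff.2 fun x ε hε => ?_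
    obtain ⟨f, hf⟩ := (denseRange_toH d m k).exists_dist_lt x (half_pos hε)
    obtain ⟨p, ⟨n, hn⟩, hp, -⟩ := exists_polyH_near hk f (half_pos hε)
    refine ⟨toH d m k p, ?_, Set.mem_iUnion.2 ⟨n, hn⟩⟩
    rw [mem_ball, dist_comm]
    refine (dist_triangle x (toH d m k f) _).trans_lt ?_
    rw [← dist_eq_norm] at hp
    linarith
  · rintro n _ ⟨f, -, rfl⟩
    exact ⟨f, rfl⟩
  · rintro n x ⟨f, hf, hx⟩
    rw [happly f x hx]
    exact ⟨_, freeOp_mem_polyLT hf, rfl⟩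
  · rintro n x ⟨f, hf, hx⟩
    rw [happly f x hx, ← hx, inner_toH, norm_toH_sq]
    exact re_ipH_freeOp_le hd k f
  · rintro ⟨x, y⟩ hxy
    obtain ⟨f, rfl, rfl⟩ := (mem_graph_freeGenerator hd0 _ _).1 hxy
    refine Metric.mem_closure_iff.2 fun ε hε => ?_
    obtain ⟨p, ⟨n, hn⟩, h1, h2⟩ := exists_polyH_near hk f hε
    refine ⟨(toH d m k p, toH d m k (freeOpPair d m k p)),
      ⟨n, hn, (mem_graph_freeGenerator hd0 _ _).2 ⟨p, rfl, rfl⟩⟩, ?_⟩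
    rw [Prod.dist_eq, max_lt_iff, dist_eq_norm, dist_eq_norm]
    exact ⟨h1, h2⟩
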